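/- **Theorem (optimal random stepsizes).** Let $0<m\le M<\infty$ and $\kappa=M/m$. Let $r_0,r_1,\dots$ be i.i.d. random variables with the arcsine distribution on $(m,M)$, i.e. with density $\frac{1}{\pi\sqrt{(M-z)(z-m)}}\mathbf 1[z\in(m,M)]$ (if $m=M$, the point mass at $m$), and put $h_t=r_t^{-1/2}$. A *bilinear problem with spectral bounds $m,M$* is a problem $\min_{x\in\mathbb R^{d_x}}\max_{y\in\mathbb R^{d_y}} f(x,y)$, $f(x,y)=(x-\tilde x)^\top B(y-\tilde y)$, all of whose nonzero squared singular values of $B$ lie in $[m,M]$. Gradient descent-ascent (GDA) with stepsizes $\alpha_n,\beta_n$ is $$x_{n+1}=x_n-\alpha_n\nabla_xf(x_n,y_n),\qquad y_{n+1}=y_n+\beta_n\nabla_yf(x_n,y_n),\qquad z_n=(x_n,y_n),$$ and we use the paired stepsizes $\alpha_{2t}=-\alpha_{2t+1}=-\beta_{2t}=\beta_{2t+1}=h_t$ for $t=0,1,\dots$ 1. There are nonnegative random variables $C_T$, $T=0,1,\dots$, which do not depend on the dimensions, the problem or the initialization, with $$\lim_{T\to\infty}C_T^{1/T}=\frac{\sqrt\kappa-1}{\sqrt\kappa+1}\quad\text{almost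 surely},$$ such that for all dimensions $d_x,d_y$, every bilinear problem with spectral bounds $m,M$ and every initialization $z_0=(x_0,y_0)$ there is a saddle point $z^*$ with $\|z_{2T}-z^*\|\le C_T\|z_0-z^*\|$ for all $T$, and $z_n\to z^*$ almost surely. (Norms are Euclidean.) 2. This asymptotic rate is optimal. An *asymmetric Krylov-subspace algorithm* produces from every bilinear problem and every $z_0$ a sequence starting at $z_0$ with $x_t\in x_0+\mathrm{span}\{\nabla_xf(x_s,y_s):s<t\}$ and $y_t\in y_0+\mathrm{span}\{\nabla_yf(x_s,y_s):s<t\}$ for all $t$ (GDA with arbitrary stepsizes is of this kind). For each $T$ let $A_T$ be such an algorithm, and let $c_T$ be real numbers such that for every $T$, every bilinear problem with spectral bounds $m,M$ in any dimensions and every $z_0$, the iterates of $A_T$ satisfy $\|z_{2T}-z^*\|\le c_T\|z_0-z^*\|$ for some saddle point $z^*$. Then $\liminf_{T\to\infty}c_T^{1/T}\ge\frac{\sqrt\kappa-1}{\sqrt\kappa+1}$. -/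

import Mathlib

open Real Filter Topology MeasureTheory ProbabilityTheory

namespace Slingshot

noncomputable section

/-- The product `ℝ^dx × ℝ^dy` with its Euclidean norm; its points are `z = (x, y)`. -/
abbrev Z (dx dy : ℕ) : Type :=
  WithLp 2 (EuclideanSpace ℝ (Fin dx) × EuclideanSpace ℝ (Fin dy))

/-- The gradient `∇_x f` at `z = (x, y)`. -/
def gradX {dx dy : ℕ} (f : EuclideanSpace ℝ (Fin dx) → EuclideanSpace ℝ (Fin dy) → ℝ)
    (z : Z dx dy) : EuclideanSpace ℝ (Fin dx) :=
  gradient (fun x => f x z.snd) z.fst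

/-- The gradient `∇_y f` at `z = (x, y)`. -/
def gradY {dx dy : ℕ} (f : EuclideanSpace ℝ (Fin dx) → EuclideanSpace ℝ (Fin dy) → ℝ)
    (z : Z dx dy) : EuclideanSpace ℝ (Fin dy) :=
  gradient (fun y => f z.fst y) z.snd

/-- `z = (x, y)` is a saddle point of `min_x max_y f(x, y)`. -/
def IsSaddlePoint {dx dy : ℕ} (f : EuclideanSpace ℝ (Fin dx) → EuclideanSpace ℝ (Fin dy) → ℝ)
    (z : Z dx dy) : Prop :=
  ∀ x y, f z.fst y ≤ f z.fst z.snd ∧ f z.fst z.snd ≤ f x z.snd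

/-- Gradient descent-ascent for `min_x max_y f(x, y)` with stepsizes `α` (for `x`) and `β`
(for `y`), started at `z₀`; both updates use the gradients at the current point. -/
def gda {dx dy : ℕ} (f : EuclideanSpace ℝ (Fin dx) → EuclideanSpace ℝ (Fin dy) → ℝ)
    (α β : ℕ → ℝ) (z₀ : Z dx dy) : ℕ → Z dx dy
  | 0 => z₀
  | n + 1 => WithLp.toLp 2
      ((gda f α β z₀ n).fst - α n • gradX f (gda f α β z₀ n),
        (gda f α β z₀ n).snd + β n • gradY f (gda f α β z₀ n))

/-- A bilinear min-max problem: the coupling matrix `B` and the centers `xc`, `yc`. -/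
structure BilinearProblem (dx dy : ℕ) where
  B : Matrix (Fin dx) (Fin dy) ℝ
  xc : EuclideanSpace ℝ (Fin dx)
  yc : EuclideanSpace ℝ (Fin dy)

/-- The objective `f(x, y) = (x - xc)ᵀ B (y - yc)`. -/
def BilinearProblem.objective {dx dy : ℕ} (P : BilinearProblem dx dy)
    (x : EuclideanSpace ℝ (Fin dx)) (y : EuclideanSpace ℝ (Fin dy)) : ℝ :=
  inner ℝ (x - P.xc) (Matrix.toEuclideanLin P.B (y - P.yc))

/-- All nonzero squared singular values of the coupling matrix lie in `[m, M]`. -/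
def BilinearProblem.SpectralBounds {dx dy : ℕ} (P : BilinearProblem dx dy) (m M : ℝ) : Prop :=
  ∀ i : ℕ, (Matrix.toEuclideanLin P.B).singularValues i ≠ 0 →
    (Matrix.toEuclideanLin P.B).singularValues i ^ 2 ∈ Set.Icc m M

/-- The paired stepsizes `α_{2t} = h_t`, `α_{2t+1} = -h_t` of the minimization variable. -/
def slingshotX (h : ℕ → ℝ) (n : ℕ) : ℝ := if Even n then h (n / 2) else -h (n / 2)

/-- The paired stepsizes `β_{2t} = -h_t`, `β_{2t+1} = h_t` of the maximization variable. -/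
def slingshotY (h : ℕ → ℝ) (n : ℕ) : ℝ := if Even n then -h (n / 2) else h (n / 2)

/-- The arcsine distribution on `(m, M)`, with density `1 / (π √((M - z)(z - m)))` there.
In the degenerate case `m = M` it is the point mass at `m`. -/
def arcsineMeasure (m M : ℝ) : Measure ℝ :=
  if m < M then
    volume.withDensity fun z => ENNReal.ofReal
      ((Set.Ioo m M).indicator (fun z => 1 / (π * √((M - z) * (z - m)))) z)
  else Measure.dirac m

/-- The sequence `z` could have been produced on `f` by an asymmetric Krylov-subspace
(first-order) algorithm: `x_t ∈ x₀ + span {∇_x f(z_s) : s < t}` and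
`y_t ∈ y₀ + span {∇_y f(z_s) : s < t}`. -/
def IsKrylovSequence {dx dy : ℕ}
    (f : EuclideanSpace ℝ (Fin dx) → EuclideanSpace ℝ (Fin dy) → ℝ) (z : ℕ → Z dx dy) : Prop :=
  ∀ t : ℕ,
    (z t).fst - (z 0).fst ∈ Submodule.span ℝ ((fun s => gradX f (z s)) '' Set.Iio t) ∧
    (z t).snd - (z 0).snd ∈ Submodule.span ℝ ((fun s => gradY f (z s)) '' Set.Iio t)

/-- `A` assigns to every bilinear problem and every initialization a sequence of iterates. -/
abbrev BilinearMethod : Type :=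
  (dx dy : ℕ) → BilinearProblem dx dy → Z dx dy → ℕ → Z dx dy

/-- `A` is an asymmetric Krylov-subspace algorithm; its coefficients may depend on the problem
(adaptively or not). Gradient descent-ascent with any stepsizes is of this kind. -/
def IsKrylovMethod (A : BilinearMethod) : Prop :=
  ∀ (dx dy : ℕ) (P : BilinearProblem dx dy) (z₀ : Z dx dy),
    A dx dy P z₀ 0 = z₀ ∧ IsKrylovSequence P.objective (A dx dy P z₀)

/-- For every `T`, the method `A T` (which may be designed for the horizon `2 T`) contracts the
distance to some saddle point by the factor `c T` within `2 T` iterations, on all bilinear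
problems with spectral bounds `m`, `M` and from all initializations. -/
def HasRate (A : ℕ → BilinearMethod) (m M : ℝ) (c : ℕ → ℝ) : Prop :=
  ∀ (T dx dy : ℕ) (P : BilinearProblem dx dy), P.SpectralBounds m M → ∀ z₀ : Z dx dy,
    ∃ zs : Z dx dy, IsSaddlePoint P.objective zs ∧
      ‖A T dx dy P z₀ (2 * T) - zs‖ ≤ c T * ‖z₀ - zs‖

end

end Slingshot

/-!
Write `m = (a - b) ^ 2` and `M = (a + b) ^ 2` with `0 ≤ b < a`. The claimed rate is `b / a`, and
`[m, M]` consists of the points `|a + b w| ^ 2` with `|w| = 1`.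

**Dynamics.** Relative to a saddle point, two consecutive steps with the stepsizes `± h t` multiply
the `x`-block by `1 - h t ^ 2 • B Bᵀ` and the `y`-block by `1 - h t ^ 2 • Bᵀ B`. Relative to the
nearest saddle point the components in the kernels vanish, so the spectral theorem bounds the
contraction after `2 T` steps by the maximum over `[m, M]` of the residual polynomial
`∏ (1 - h t ^ 2 * l)` (`norm_gda_slingshot_sub_le`). This maximum is the random variable `C T`
(`residualSup`).

**Lower bound.** If `p` has degree at most `T` and `p 0 = 1`, then `w ^ T * p (|a + b w| ^ 2)`
extends from the unit circle to a polynomial in `w` of degree at most `2 T` whose value at `-b / a`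
is `± (b / a) ^ T`. A discrete Fourier transform over `N > 2 T` roots of unity bounds this value by
the average of `|p|` over `N` points of `[m, M]`, up to a constant factor
(`pow_mul_one_sub_le_average`). Hence `C T ≥ (1 - b / a) * (b / a) ^ T`. The same `N` points are
the squared singular values of a diagonal problem on which every Krylov-subspace method, started at
`x₀ = (1, …, 1)`, `y₀ = 0`, applies a residual polynomial of degree at most `T` to `x₀` within
`2 T` steps; this gives the optimality (`pow_mul_one_sub_le_of_hasRate`).

**Upper bound.** With `r = |a + b e^{iθ}| ^ 2`, where `θ` is uniform, and `l = |a + b e^{iφ}| ^ 2`,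
`|r - l| = a b |e^{iθ} - e^{iφ}| |e^{iθ} - e^{-iφ}|`. Moving `e^{± iφ}` out to the radius `R > 1`
increases both factors and makes the logarithm continuous, and its mean becomes exactly
`log (a b) + 2 log R` for every `l`, as `log |w - u|` is harmonic on the disc if `|u| > 1`
(`integral_smoothedLog`). Since `log r` has the mean `2 log a`, a law of large numbers, uniform in
`l` by compactness (`ae_eventually_sum_le_of_integral_le`), shows that almost surely
`C T ≤ q ^ T` eventually, for every `q > b / a`.
-/

namespace Slingshot

/-! ### Two steps of the paired stepsizes and the spectral theorem -/

/-- In an eigenbasis of `A` the coordinates of `x T` are those of `x 0` times the residual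
polynomial `∏ (1 - g t * l)` at the eigenvalues `l`, and the coordinates for the eigenvalue `0`
vanish. -/
lemma norm_le_of_residual_bound {E : Type*} [NormedAddCommGroup E] [InnerProductSpace ℝ E]
    [FiniteDimensional ℝ E] {A : E →ₗ[ℝ] E} (hA : A.IsSymmetric) {S : Set ℝ}
    (hS : ∀ l : ℝ, l ≠ 0 → Module.End.HasEigenvalue A l → l ∈ S) (g : ℕ → ℝ) (T : ℕ) {K : ℝ}
    (hK0 : 0 ≤ K) (hK : ∀ l ∈ S, |∏ t ∈ Finset.range T, (1 - g t * l)| ≤ K) (x : ℕ → E)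
    (hx0 : ∀ v, A v = 0 → inner ℝ v (x 0) = 0)
    (hx : ∀ t, x (t + 1) = x t - g t • A (x t)) : ‖x T‖ ≤ K * ‖x 0‖ := by
  set e := hA.eigenvectorBasis rfl with he
  set l := hA.eigenvalues rfl with hl
  have hcoord : ∀ t i, e.repr (x t) i
      = (∏ s ∈ Finset.range t, (1 - g s * l i)) * e.repr (x 0) i := by
    intro t i
    induction t with
    | zero => simp
    | succ t ih =>
      have := hA.eigenvectorBasis_apply_self_apply rfl (x t) i
      rw [hx, map_sub, map_smul, Finset.prod_range_succ]
      simp only [PiLp.sub_apply, PiLp.smul_apply, smul_eq_mul]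
      rw [he, this, ← he, ih]
      simp only [RCLike.ofReal_real_eq_id, id]
      ring
  have hle : ∀ i, ‖e.repr (x T) i‖ ≤ K * ‖e.repr (x 0) i‖ := by
    intro i
    rw [hcoord T i, norm_mul, Real.norm_eq_abs]
    by_cases h0 : l i = 0
    · have : e.repr (x 0) i = 0 := by
        rw [e.repr_apply_apply]
        refine hx0 _ ?_
        rw [he, hA.apply_eigenvectorBasis rfl i, ← hl, h0]
        simp
      simp [this]
    · exact mul_le_mul_of_nonneg_right
        (hK _ (hS _ h0 (hA.hasEigenvalue_eigenvalues rfl i))) (norm_nonneg _)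
  rw [← e.repr.norm_map (x T), ← e.repr.norm_map (x 0)]
  refine le_of_sq_le_sq ?_ (by positivity)
  rw [mul_pow, EuclideanSpace.norm_sq_eq, EuclideanSpace.norm_sq_eq, Finset.mul_sum]
  refine Finset.sum_le_sum fun i _ => ?_
  rw [← mul_pow]
  exact pow_le_pow_left₀ (norm_nonneg _) (hle i) 2

lemma mem_of_hasEigenvalue_adjoint_comp_self {E F : Type*} [NormedAddCommGroup E]
    [InnerProductSpace ℝ E] [FiniteDimensional ℝ E] [NormedAddCommGroup F]
    [InnerProductSpace ℝ F] [FiniteDimensional ℝ F] (L : E →ₗ[ℝ] F) {S : Set ℝ}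
    (hS : ∀ i : ℕ, L.singularValues i ≠ 0 → L.singularValues i ^ 2 ∈ S) {l : ℝ} (hl : l ≠ 0)
    (h : Module.End.HasEigenvalue (LinearMap.adjoint L ∘ₗ L) l) : l ∈ S := by
  obtain ⟨i, hi⟩ := L.isSymmetric_adjoint_comp_self.exists_eigenvalues_eq rfl h
  have h2 := L.sq_singularValues_fin rfl i
  rw [show L.isSymmetric_adjoint_comp_self.eigenvalues rfl i = l from hi] at h2
  rw [← h2]
  refine hS _ fun h0 => hl ?_
  rw [← h2, h0]
  norm_num

lemma hasEigenvalue_adjoint_comp_self_of_comp_adjoint {E F : Type*} [NormedAddCommGroup E]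
    [InnerProductSpace ℝ E] [FiniteDimensional ℝ E] [NormedAddCommGroup F]
    [InnerProductSpace ℝ F] [FiniteDimensional ℝ F] (L : E →ₗ[ℝ] F) {l : ℝ} (hl : l ≠ 0)
    (h : Module.End.HasEigenvalue (L ∘ₗ LinearMap.adjoint L) l) :
    Module.End.HasEigenvalue (LinearMap.adjoint L ∘ₗ L) l := by
  obtain ⟨v, hv⟩ := h.exists_hasEigenvector
  have hv1 : L (LinearMap.adjoint L v) = l • v := hv.apply_eq_smul
  refine Module.End.hasEigenvalue_of_hasEigenvector (x := LinearMap.adjoint L v)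
    ⟨Module.End.mem_eigenspace_iff.2 ?_, fun h0 => ?_⟩
  · simp [hv1]
  · rw [h0, map_zero] at hv1
    exact (smul_ne_zero hl hv.2) hv1.symm

lemma inner_eq_zero_of_adjoint_apply_self_eq_zero {E F : Type*} [NormedAddCommGroup E]
    [InnerProductSpace ℝ E] [FiniteDimensional ℝ E] [NormedAddCommGroup F]
    [InnerProductSpace ℝ F] [FiniteDimensional ℝ F] (L : E →ₗ[ℝ] F) {v w : E}
    (hw : w ∈ (LinearMap.ker L)ᗮ) (hv : LinearMap.adjoint L (L v) = 0) : inner ℝ v w = 0 := by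
  refine Submodule.inner_right_of_mem_orthogonal ?_ hw
  rw [LinearMap.mem_ker, ← inner_self_eq_zero (𝕜 := ℝ), ← LinearMap.adjoint_inner_right, hv,
    inner_zero_right]

variable {dx dy : ℕ}

lemma gradX_objective (P : BilinearProblem dx dy) (z : Z dx dy) :
    gradX P.objective z = Matrix.toEuclideanLin P.B (z.snd - P.yc) := by
  refine HasGradientAt.gradient ?_
  rw [hasGradientAt_iff_hasFDerivAt]
  have h := ((InnerProductSpace.toDual ℝ _
    (Matrix.toEuclideanLin P.B (z.snd - P.yc))).hasFDerivAt (x := z.fst - P.xc)).comp z.fst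
    ((hasFDerivAt_id z.fst).sub_const P.xc)
  rw [ContinuousLinearMap.comp_id] at h
  refine h.congr_of_eventuallyEq (Eventually.of_forall fun x => ?_)
  simp only [BilinearProblem.objective, Function.comp_apply, id, InnerProductSpace.toDual_apply_apply]
  rw [real_inner_comm]

lemma gradY_objective (P : BilinearProblem dx dy) (z : Z dx dy) :
    gradY P.objective z
      = LinearMap.adjoint (Matrix.toEuclideanLin P.B) (z.fst - P.xc) := by
  refine HasGradientAt.gradient ?_
  rw [hasGradientAt_iff_hasFDerivAt]
  have h := ((InnerProductSpace.toDual ℝ _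
    (LinearMap.adjoint (Matrix.toEuclideanLin P.B) (z.fst - P.xc))).hasFDerivAt
      (x := z.snd - P.yc)).comp z.snd ((hasFDerivAt_id z.snd).sub_const P.yc)
  rw [ContinuousLinearMap.comp_id] at h
  refine h.congr_of_eventuallyEq (Eventually.of_forall fun x => ?_)
  simp only [BilinearProblem.objective, Function.comp_apply, id, InnerProductSpace.toDual_apply_apply]
  rw [LinearMap.adjoint_inner_left]

lemma isSaddlePoint_iff (P : BilinearProblem dx dy) {zs : Z dx dy} :
    IsSaddlePoint P.objective zs ↔
      LinearMap.adjoint (Matrix.toEuclideanLin P.B) (zs.fst - P.xc) = 0 ∧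
        Matrix.toEuclideanLin P.B (zs.snd - P.yc) = 0 := by
  refine ⟨fun h => ?_, fun ⟨hx, hy⟩ => ?_⟩
  · -- the value at a saddle point is squeezed between `f(x, yc) = 0` and `f(xc, y) = 0`
    have h1 : P.objective zs.fst P.yc = 0 := by simp [BilinearProblem.objective]
    have h2 : P.objective P.xc zs.snd = 0 := by simp [BilinearProblem.objective]
    have h0 : P.objective zs.fst zs.snd = 0 :=
      le_antisymm (h2 ▸ (h P.xc zs.snd).2) (h1 ▸ (h zs.fst P.yc).1)
    constructor
    · have := (h zs.fst (P.yc + LinearMap.adjoint (Matrix.toEuclideanLin P.B)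
        (zs.fst - P.xc))).1
      rw [h0, BilinearProblem.objective, add_sub_cancel_left, ← LinearMap.adjoint_inner_left] at this
      exact real_inner_self_nonpos.1 this
    · have := (h (P.xc - Matrix.toEuclideanLin P.B (zs.snd - P.yc)) zs.snd).2
      rw [h0, BilinearProblem.objective, sub_sub_cancel_left, inner_neg_left] at this
      exact real_inner_self_nonpos.1 (neg_nonneg.1 this)
  · have h1 : ∀ y, P.objective zs.fst y = 0 := fun y => by
      rw [BilinearProblem.objective, ← LinearMap.adjoint_inner_left, hx, inner_zero_left]
    have h2 : ∀ x, P.objective x zs.snd = 0 := fun x => by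
      rw [BilinearProblem.objective, hy, inner_zero_right]
    exact fun x y => by rw [h1, h1, h2]; exact ⟨le_rfl, le_rfl⟩

/-- The saddle point closest to `z₀`: the two components of `z₀`, relative to the centers, are
projected to the kernels of `Bᵀ` and `B`. -/
noncomputable def nearestSaddle (P : BilinearProblem dx dy) (z₀ : Z dx dy) : Z dx dy :=
  WithLp.toLp 2
    (P.xc + ((LinearMap.ker (LinearMap.adjoint (Matrix.toEuclideanLin P.B))).starProjection
        (z₀.fst - P.xc)),
      P.yc + ((LinearMap.ker (Matrix.toEuclideanLin P.B)).starProjection (z₀.snd - P.yc)))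

lemma adjoint_nearestSaddle (P : BilinearProblem dx dy) (z₀ : Z dx dy) :
    LinearMap.adjoint (Matrix.toEuclideanLin P.B) ((nearestSaddle P z₀).fst - P.xc) = 0 := by
  rw [nearestSaddle, WithLp.toLp_fst, add_sub_cancel_left]
  exact LinearMap.mem_ker.1 (Submodule.starProjection_apply_mem _ _)

lemma apply_nearestSaddle (P : BilinearProblem dx dy) (z₀ : Z dx dy) :
    Matrix.toEuclideanLin P.B ((nearestSaddle P z₀).snd - P.yc) = 0 := by
  rw [nearestSaddle, WithLp.toLp_snd, add_sub_cancel_left]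
  exact LinearMap.mem_ker.1 (Submodule.starProjection_apply_mem _ _)

lemma isSaddlePoint_nearestSaddle (P : BilinearProblem dx dy) (z₀ : Z dx dy) :
    IsSaddlePoint P.objective (nearestSaddle P z₀) :=
  (isSaddlePoint_iff P).2 ⟨adjoint_nearestSaddle P z₀, apply_nearestSaddle P z₀⟩

lemma gda_succ_fst_sub (P : BilinearProblem dx dy) (α β : ℕ → ℝ) (z₀ : Z dx dy) {zs : Z dx dy}
    (hy : Matrix.toEuclideanLin P.B (zs.snd - P.yc) = 0) (n : ℕ) :
    (gda P.objective α β z₀ (n + 1)).fst - zs.fst = ((gda P.objective α β z₀ n).fst - zs.fst)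
      - α n • Matrix.toEuclideanLin P.B ((gda P.objective α β z₀ n).snd - zs.snd) := by
  rw [show (gda P.objective α β z₀ n).snd - zs.snd
    = ((gda P.objective α β z₀ n).snd - P.yc) - (zs.snd - P.yc) by abel, map_sub, hy, sub_zero,
    ← gradX_objective, gda, WithLp.toLp_fst, sub_right_comm]

lemma gda_succ_snd_sub (P : BilinearProblem dx dy) (α β : ℕ → ℝ) (z₀ : Z dx dy) {zs : Z dx dy}
    (hx : LinearMap.adjoint (Matrix.toEuclideanLin P.B) (zs.fst - P.xc) = 0) (n : ℕ) :
    (gda P.objective α β z₀ (n + 1)).snd - zs.snd = ((gda P.objective α β z₀ n).snd - zs.snd)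
      + β n • LinearMap.adjoint (Matrix.toEuclideanLin P.B)
          ((gda P.objective α β z₀ n).fst - zs.fst) := by
  rw [show (gda P.objective α β z₀ n).fst - zs.fst
    = ((gda P.objective α β z₀ n).fst - P.xc) - (zs.fst - P.xc) by abel, map_sub, hx, sub_zero,
    ← gradY_objective, gda, WithLp.toLp_snd, add_sub_right_comm]

lemma slingshotX_even (h : ℕ → ℝ) (t : ℕ) : slingshotX h (2 * t) = h t := by
  simp [slingshotX]

lemma slingshotX_odd (h : ℕ → ℝ) (t : ℕ) : slingshotX h (2 * t + 1) = -h t := by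
  rw [slingshotX, if_neg (by simp), show (2 * t + 1) / 2 = t by omega]

lemma slingshotY_even (h : ℕ → ℝ) (t : ℕ) : slingshotY h (2 * t) = -h t := by
  simp [slingshotY]

lemma slingshotY_odd (h : ℕ → ℝ) (t : ℕ) : slingshotY h (2 * t + 1) = h t := by
  rw [slingshotY, if_neg (by simp), show (2 * t + 1) / 2 = t by omega]

lemma gda_slingshot_two_step_fst (P : BilinearProblem dx dy) (h : ℕ → ℝ) (z₀ : Z dx dy)
    {zs : Z dx dy}
    (hx : LinearMap.adjoint (Matrix.toEuclideanLin P.B) (zs.fst - P.xc) = 0)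
    (hy : Matrix.toEuclideanLin P.B (zs.snd - P.yc) = 0) (t : ℕ) :
    (gda P.objective (slingshotX h) (slingshotY h) z₀ (2 * (t + 1))).fst - zs.fst
      = ((gda P.objective (slingshotX h) (slingshotY h) z₀ (2 * t)).fst - zs.fst) - h t ^ 2 •
        (Matrix.toEuclideanLin P.B ∘ₗ LinearMap.adjoint (Matrix.toEuclideanLin P.B))
          ((gda P.objective (slingshotX h) (slingshotY h) z₀ (2 * t)).fst - zs.fst) := by
  rw [show 2 * (t + 1) = 2 * t + 1 + 1 by ring, gda_succ_fst_sub P _ _ _ hy,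
    gda_succ_fst_sub P _ _ _ hy, gda_succ_snd_sub P _ _ _ hx, slingshotX_even, slingshotX_odd,
    slingshotY_even, map_add, map_smul, LinearMap.comp_apply]
  module

lemma gda_slingshot_two_step_snd (P : BilinearProblem dx dy) (h : ℕ → ℝ) (z₀ : Z dx dy)
    {zs : Z dx dy}
    (hx : LinearMap.adjoint (Matrix.toEuclideanLin P.B) (zs.fst - P.xc) = 0)
    (hy : Matrix.toEuclideanLin P.B (zs.snd - P.yc) = 0) (t : ℕ) :
    (gda P.objective (slingshotX h) (slingshotY h) z₀ (2 * (t + 1))).snd - zs.snd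
      = ((gda P.objective (slingshotX h) (slingshotY h) z₀ (2 * t)).snd - zs.snd) - h t ^ 2 •
        (LinearMap.adjoint (Matrix.toEuclideanLin P.B) ∘ₗ Matrix.toEuclideanLin P.B)
          ((gda P.objective (slingshotX h) (slingshotY h) z₀ (2 * t)).snd - zs.snd) := by
  rw [show 2 * (t + 1) = 2 * t + 1 + 1 by ring, gda_succ_snd_sub P _ _ _ hx,
    gda_succ_snd_sub P _ _ _ hx, gda_succ_fst_sub P _ _ _ hy, slingshotX_even, slingshotY_odd,
    slingshotY_even, map_sub (LinearMap.adjoint (Matrix.toEuclideanLin P.B)) (_ - _) (_ • _),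
    map_smul, LinearMap.comp_apply]
  module

lemma norm_gda_slingshot_sub_le (P : BilinearProblem dx dy) {m M : ℝ} (hP : P.SpectralBounds m M)
    (h : ℕ → ℝ) (T : ℕ) {K : ℝ} (hK0 : 0 ≤ K)
    (hK : ∀ l ∈ Set.Icc m M, |∏ t ∈ Finset.range T, (1 - h t ^ 2 * l)| ≤ K) (z₀ : Z dx dy) :
    ‖gda P.objective (slingshotX h) (slingshotY h) z₀ (2 * T) - nearestSaddle P z₀‖
      ≤ K * ‖z₀ - nearestSaddle P z₀‖ := by
  set L := Matrix.toEuclideanLin P.B with hL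
  set zs := nearestSaddle P z₀ with hzs
  set z := gda P.objective (slingshotX h) (slingshotY h) z₀ with hz
  have hx := adjoint_nearestSaddle P z₀
  have hy := apply_nearestSaddle P z₀
  have hS := fun l hl => mem_of_hasEigenvalue_adjoint_comp_self L hP (l := l) hl
  have h1 : ‖(z (2 * T)).fst - zs.fst‖ ≤ K * ‖(z (2 * 0)).fst - zs.fst‖ := by
    refine norm_le_of_residual_bound (A := L ∘ₗ LinearMap.adjoint L)
      (by simpa using (LinearMap.adjoint L).isSymmetric_adjoint_comp_self)
      (fun l hl he => hS l hl (hasEigenvalue_adjoint_comp_self_of_comp_adjoint L hl he))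
      (fun t => h t ^ 2) T hK0 hK (fun t => (z (2 * t)).fst - zs.fst) (fun v hv => ?_)
      (gda_slingshot_two_step_fst P h z₀ hx hy)
    refine inner_eq_zero_of_adjoint_apply_self_eq_zero (LinearMap.adjoint L) ?_ (by simpa using hv)
    have := Submodule.sub_starProjection_mem_orthogonal
      (K := LinearMap.ker (LinearMap.adjoint L)) (z₀.fst - P.xc)
    simpa [hz, hzs, gda, nearestSaddle, ← hL, sub_sub] using this
  have h2 : ‖(z (2 * T)).snd - zs.snd‖ ≤ K * ‖(z (2 * 0)).snd - zs.snd‖ := by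
    refine norm_le_of_residual_bound (A := LinearMap.adjoint L ∘ₗ L)
      L.isSymmetric_adjoint_comp_self hS
      (fun t => h t ^ 2) T hK0 hK (fun t => (z (2 * t)).snd - zs.snd) (fun v hv => ?_)
      (gda_slingshot_two_step_snd P h z₀ hx hy)
    refine inner_eq_zero_of_adjoint_apply_self_eq_zero L ?_ (by simpa using hv)
    have := Submodule.sub_starProjection_mem_orthogonal
      (K := LinearMap.ker L) (z₀.snd - P.yc)
    simpa [hz, hzs, gda, nearestSaddle, ← hL, sub_sub] using this
  refine le_of_sq_le_sq ?_ (by positivity)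
  rw [mul_pow, WithLp.prod_norm_sq_eq_of_L2, WithLp.prod_norm_sq_eq_of_L2, mul_add, ← mul_pow,
    ← mul_pow]
  exact add_le_add (pow_le_pow_left₀ (norm_nonneg _) h1 2) (pow_le_pow_left₀ (norm_nonneg _) h2 2)

lemma tendsto_of_tendsto_even_odd {α : Type*} {l : Filter α} {u : ℕ → α}
    (h0 : Tendsto (fun n => u (2 * n)) atTop l) (h1 : Tendsto (fun n => u (2 * n + 1)) atTop l) :
    Tendsto u atTop l := by
  intro s hs
  obtain ⟨N0, hN0⟩ := eventually_atTop.1 (h0.eventually hs)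
  obtain ⟨N1, hN1⟩ := eventually_atTop.1 (h1.eventually hs)
  refine mem_map.2 (eventually_atTop.2 ⟨2 * N0 + 2 * N1, fun n hn => ?_⟩)
  obtain ⟨k, rfl | rfl⟩ := Nat.even_or_odd' n
  · exact hN0 k (by omega)
  · exact hN1 k (by omega)

/-- Bounded stepsizes change the distance to a saddle point by a bounded factor in each step, so
convergence along the even iterates implies convergence. -/
lemma tendsto_gda_slingshot (P : BilinearProblem dx dy) (h : ℕ → ℝ) {H : ℝ} (hH : ∀ t, |h t| ≤ H)
    (z₀ : Z dx dy) {zs : Z dx dy}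
    (hx : LinearMap.adjoint (Matrix.toEuclideanLin P.B) (zs.fst - P.xc) = 0)
    (hy : Matrix.toEuclideanLin P.B (zs.snd - P.yc) = 0)
    (heven : Tendsto (fun t => gda P.objective (slingshotX h) (slingshotY h) z₀ (2 * t)) atTop
      (𝓝 zs)) :
    Tendsto (gda P.objective (slingshotX h) (slingshotY h) z₀) atTop (𝓝 zs) := by
  set z := gda P.objective (slingshotX h) (slingshotY h) z₀ with hz
  have hfst : Tendsto (fun t => (z (2 * t)).fst - zs.fst) atTop (𝓝 0) := by
    rw [← sub_self zs.fst]
    exact (((WithLp.continuous_fst ..).tendsto zs).comp heven).sub_const _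
  have hsnd : Tendsto (fun t => (z (2 * t)).snd - zs.snd) atTop (𝓝 0) := by
    rw [← sub_self zs.snd]
    exact (((WithLp.continuous_snd ..).tendsto zs).comp heven).sub_const _
  have hbd : IsBoundedUnder (· ≤ ·) atTop (norm ∘ h) :=
    isBoundedUnder_of ⟨H, fun t => hH t⟩
  have hLs : Tendsto (fun t => h t • Matrix.toEuclideanLin P.B ((z (2 * t)).snd - zs.snd)) atTop
      (𝓝 0) := by
    refine hbd.smul_tendsto_zero ?_
    simpa [Function.comp_def] using
      ((Matrix.toEuclideanLin P.B).continuous_of_finiteDimensional.tendsto 0).comp hsnd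
  have hLf : Tendsto (fun t => h t • LinearMap.adjoint (Matrix.toEuclideanLin P.B)
      ((z (2 * t)).fst - zs.fst)) atTop (𝓝 0) := by
    refine hbd.smul_tendsto_zero ?_
    simpa [Function.comp_def] using ((LinearMap.adjoint
      (Matrix.toEuclideanLin P.B)).continuous_of_finiteDimensional.tendsto 0).comp hfst
  have h1 : Tendsto (fun t => (z (2 * t + 1)).fst) atTop (𝓝 zs.fst) := by
    rw [← tendsto_sub_nhds_zero_iff]
    simp_rw [hz, gda_succ_fst_sub P _ _ _ hy, slingshotX_even]
    simpa using hfst.sub hLs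
  have h2 : Tendsto (fun t => (z (2 * t + 1)).snd) atTop (𝓝 zs.snd) := by
    rw [← tendsto_sub_nhds_zero_iff]
    simp_rw [hz, gda_succ_snd_sub P _ _ _ hx, slingshotY_even, neg_smul]
    simpa using hsnd.add hLf.neg
  refine tendsto_of_tendsto_even_odd heven ?_
  exact ((WithLp.prod_continuous_toLp 2 _ _).tendsto (zs.fst, zs.snd)).comp (h1.prodMk_nhds h2)

end Slingshot

namespace Slingshot

/-! ### A lower bound for residual polynomials -/

/-- The coefficients of a polynomial are discrete Fourier transforms of its values at the roots of
unity, so they are bounded by the average absolute value there. -/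
lemma norm_eval_le_of_rootsOfUnity {N : ℕ} (hN : N ≠ 0) {ζ : ℂ} (hζ : IsPrimitiveRoot ζ N)
    {q : Polynomial ℂ} (hq : q.natDegree < N) (w : ℂ) :
    ‖q.eval w‖ ≤ (∑ k ∈ Finset.range N, ‖w‖ ^ k) *
      ((∑ j ∈ Finset.range N, ‖q.eval (ζ ^ j)‖) / N) := by
  have hN' : (0 : ℝ) < N := by positivity
  have hζ0 : ζ ≠ 0 := hζ.ne_zero hN
  have hcoeff : ∀ k < N, q.coeff k * N = ∑ j ∈ Finset.range N, q.eval (ζ ^ j) * (ζ⁻¹) ^ (j * k) := by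
    intro k hk
    simp_rw [Polynomial.eval_eq_sum_range' hq, Finset.sum_mul]
    rw [Finset.sum_comm, Finset.sum_eq_single_of_mem k (Finset.mem_range.2 hk)]
    · have : ∀ j ∈ Finset.range N, q.coeff k * (ζ ^ j) ^ k * ζ⁻¹ ^ (j * k) = q.coeff k := by
        intro j _
        rw [mul_assoc, ← pow_mul, ← mul_pow, mul_inv_cancel₀ hζ0, one_pow, mul_one]
      rw [Finset.sum_congr rfl this]
      simp [mul_comm]
    · intro l hl hlk
      have hx1 : ζ ^ l * ζ⁻¹ ^ k ≠ 1 := by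
        intro h
        rw [inv_pow, mul_inv_eq_one₀ (pow_ne_zero _ hζ0)] at h
        exact hlk (hζ.pow_inj (Finset.mem_range.1 hl) hk h)
      have hxN : (ζ ^ l * ζ⁻¹ ^ k) ^ N = 1 := by
        rw [mul_pow, ← pow_mul, ← pow_mul, mul_comm l, mul_comm k, pow_mul, pow_mul, inv_pow,
          hζ.pow_eq_one]
        simp
      have : ∀ j ∈ Finset.range N, q.coeff l * (ζ ^ j) ^ l * ζ⁻¹ ^ (j * k)
          = q.coeff l * (ζ ^ l * ζ⁻¹ ^ k) ^ j := by
        intro j _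
        rw [mul_pow, ← pow_mul, ← pow_mul, ← pow_mul, mul_comm j, mul_comm j, mul_assoc]
      rw [Finset.sum_congr rfl this, ← Finset.mul_sum, geom_sum_eq hx1, hxN]
      simp
  have hbound : ∀ k ∈ Finset.range N,
      ‖q.coeff k‖ ≤ (∑ j ∈ Finset.range N, ‖q.eval (ζ ^ j)‖) / N := by
    intro k hk
    rw [le_div_iff₀ hN']
    have h1 : ‖q.coeff k‖ * N = ‖q.coeff k * N‖ := by simp
    rw [h1, hcoeff k (Finset.mem_range.1 hk)]
    refine (norm_sum_le _ _).trans (Finset.sum_le_sum fun j _ => ?_)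
    rw [norm_mul, norm_pow, norm_inv, hζ.norm'_eq_one hN]
    simp
  rw [Polynomial.eval_eq_sum_range' hq, Finset.sum_mul]
  refine (norm_sum_le _ _).trans (Finset.sum_le_sum fun k hk => ?_)
  rw [norm_mul, norm_pow, mul_comm]
  exact mul_le_mul_of_nonneg_left (hbound k hk) (by positivity)

/-- The point `|a + b e^{iθ}| ^ 2` of the interval `[(a - b) ^ 2, (a + b) ^ 2]`. -/
noncomputable def spectralPoint (a b θ : ℝ) : ℝ := a ^ 2 + b ^ 2 + 2 * a * b * cos θ

lemma spectralPoint_mem {a b : ℝ} (ha : 0 ≤ a) (hb : 0 ≤ b) (θ : ℝ) :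
    spectralPoint a b θ ∈ Set.Icc ((a - b) ^ 2) ((a + b) ^ 2) := by
  have h : 0 ≤ a * b := mul_nonneg ha hb
  constructor <;> unfold spectralPoint <;>
    nlinarith [mul_nonneg h (sub_nonneg.2 (cos_le_one θ)),
      mul_nonneg h (neg_le_iff_add_nonneg.1 (neg_one_le_cos θ))]

/-- The polynomial `w ^ T * p (|a + b w| ^ 2)` on the unit circle, continued to a polynomial in
`w` by means of `|a + b w| ^ 2 = (a + b w) * (a w + b) / w`. -/
noncomputable def circleLift (a b : ℝ) (T : ℕ) (p : Polynomial ℝ) : Polynomial ℂ :=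
  ∑ k ∈ Finset.range (T + 1), Polynomial.C (p.coeff k : ℂ) *
    (((Polynomial.C (b : ℂ) * Polynomial.X + Polynomial.C (a : ℂ)) *
      (Polynomial.C (a : ℂ) * Polynomial.X + Polynomial.C (b : ℂ))) ^ k * Polynomial.X ^ (T - k))

lemma natDegree_circleLift_le (a b : ℝ) (T : ℕ) (p : Polynomial ℝ) :
    (circleLift a b T p).natDegree ≤ 2 * T := by
  refine Polynomial.natDegree_sum_le_of_forall_le _ _ fun k hk => ?_
  have hk' : k ≤ T := Nat.lt_succ_iff.1 (Finset.mem_range.1 hk)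
  refine (Polynomial.natDegree_C_mul_le _ _).trans ?_
  refine (Polynomial.natDegree_mul_le_of_le (Polynomial.natDegree_pow_le_of_le k
    (Polynomial.natDegree_mul_le_of_le Polynomial.natDegree_linear_le
      Polynomial.natDegree_linear_le)) (Polynomial.natDegree_X_pow_le _)).trans ?_
  omega

lemma norm_eval_circleLift_exp (a b : ℝ) {T : ℕ} {p : Polynomial ℝ} (hp : p.natDegree ≤ T)
    (θ : ℝ) : ‖(circleLift a b T p).eval (Complex.exp (θ * Complex.I))‖
      = |p.eval (spectralPoint a b θ)| := by
  set w := Complex.exp (θ * Complex.I) with hw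
  have hw0 : w ≠ 0 := Complex.exp_ne_zero _
  have hfac : (b * w + a) * (a * w + b) = w * (spectralPoint a b θ : ℂ) := by
    have h2 : 2 * Complex.cos θ * w = w ^ 2 + 1 := by
      rw [Complex.two_cos, add_mul, ← hw, neg_mul, Complex.exp_neg, ← hw, inv_mul_cancel₀ hw0]
      ring
    unfold spectralPoint
    push_cast
    linear_combination (-(a : ℂ) * b) * h2
  have : (circleLift a b T p).eval w = w ^ T * ((p.eval (spectralPoint a b θ) : ℝ) : ℂ) := by
    rw [Polynomial.eval_eq_sum_range' (Nat.lt_succ_of_le hp), circleLift,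
      Polynomial.eval_finsetSum, Complex.ofReal_sum, Finset.mul_sum]
    refine Finset.sum_congr rfl fun k hk => ?_
    have hk' : k ≤ T := Nat.lt_succ_iff.1 (Finset.mem_range.1 hk)
    simp only [Polynomial.eval_mul, Polynomial.eval_pow, Polynomial.eval_add, Polynomial.eval_C,
      Polynomial.eval_X, hfac]
    conv_rhs => rw [← Nat.add_sub_cancel' hk', pow_add]
    push_cast
    ring
  rw [this, norm_mul, norm_pow, hw, Complex.norm_exp_ofReal_mul_I, one_pow, one_mul,
    Complex.norm_real, Real.norm_eq_abs]

lemma eval_circleLift_neg_div {a : ℝ} (b : ℝ) (ha : a ≠ 0) (T : ℕ) (p : Polynomial ℝ) :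
    (circleLift a b T p).eval ((-(b / a) : ℝ) : ℂ) = p.coeff 0 * ((-(b / a) : ℝ) : ℂ) ^ T := by
  have h0 : (a : ℂ) * ((-(b / a) : ℝ) : ℂ) + b = 0 := by
    rw [← Complex.ofReal_mul, ← Complex.ofReal_add]
    norm_cast
    field_simp
    ring
  rw [circleLift, Polynomial.eval_finsetSum,
    Finset.sum_eq_single_of_mem 0 (Finset.mem_range.2 (Nat.succ_pos T))]
  · simp
  · intro k _ hk
    simp only [Polynomial.eval_mul, Polynomial.eval_pow, Polynomial.eval_add, Polynomial.eval_C,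
      Polynomial.eval_X, h0, mul_zero, zero_pow hk, zero_mul]

/-- A polynomial `p` of degree at most `T` with `p 0 = 1` cannot be smaller on average over the
points `|a + b e^{2πij/N}| ^ 2` than `(b / a) ^ T`, up to a constant factor: its lift to the unit
circle has the value `± (b / a) ^ T` at the interior point `-b / a`. -/
theorem pow_mul_one_sub_le_average {a b : ℝ} (ha : 0 < a) (hb : 0 ≤ b) (hab : b < a) {T N : ℕ}
    (hN : 2 * T < N) {p : Polynomial ℝ} (hp : p.natDegree ≤ T) (hp0 : p.coeff 0 = 1) :
    (b / a) ^ T * (1 - b / a) ≤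
      (∑ j ∈ Finset.range N, |p.eval (spectralPoint a b (2 * π * j / N))|) / N := by
  have hN0 : N ≠ 0 := by omega
  have hρ0 : 0 ≤ b / a := by positivity
  have hρ1 : b / a < 1 := (div_lt_one ha).2 hab
  have h := norm_eval_le_of_rootsOfUnity hN0 (Complex.isPrimitiveRoot_exp N hN0)
    ((natDegree_circleLift_le a b T p).trans_lt hN) ((-(b / a) : ℝ) : ℂ)
  have hval : ∀ j ∈ Finset.range N,
      ‖(circleLift a b T p).eval (Complex.exp (2 * π * Complex.I / N) ^ j)‖
        = |p.eval (spectralPoint a b (2 * π * j / N))| := by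
    intro j _
    rw [← norm_eval_circleLift_exp a b hp, ← Complex.exp_nat_mul]
    congr 3
    push_cast
    ring
  rw [eval_circleLift_neg_div b ha.ne', hp0, Finset.sum_congr rfl hval, Complex.ofReal_one, one_mul,
    norm_pow, Complex.norm_real, norm_neg, Real.norm_of_nonneg hρ0] at h
  set S := (∑ j ∈ Finset.range N, |p.eval (spectralPoint a b (2 * π * j / N))|) / N with hS
  have hS0 : 0 ≤ S := by positivity
  have hgeom : (∑ k ∈ Finset.range N, (b / a) ^ k) * (1 - b / a) ≤ 1 := by
    rw [geom_sum_mul_neg]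
    linarith [pow_nonneg hρ0 N]
  calc (b / a) ^ T * (1 - b / a)
      ≤ (∑ k ∈ Finset.range N, (b / a) ^ k) * S * (1 - b / a) :=
        mul_le_mul_of_nonneg_right h (by linarith)
    _ = (∑ k ∈ Finset.range N, (b / a) ^ k) * (1 - b / a) * S := by ring
    _ ≤ 1 * S := mul_le_mul_of_nonneg_right hgeom hS0
    _ = S := one_mul S

end Slingshot

namespace Slingshot

/-! ### The hard instance for Krylov-subspace methods -/

/-- The problem with coupling matrix `diag(d)`, centered at the origin. -/
noncomputable def diagonalProblem {n : ℕ} (d : Fin n → ℝ) : BilinearProblem n n :=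
  ⟨Matrix.diagonal d, 0, 0⟩

lemma toEuclideanLin_diagonalProblem_apply {n : ℕ} (d : Fin n → ℝ) (x : EuclideanSpace ℝ (Fin n))
    (j : Fin n) : Matrix.toEuclideanLin (diagonalProblem d).B x j = d j * x j := by
  simp [diagonalProblem, Matrix.toLpLin_apply, Matrix.mulVec_diagonal]

lemma adjoint_toEuclideanLin_diagonalProblem {n : ℕ} (d : Fin n → ℝ) :
    LinearMap.adjoint (Matrix.toEuclideanLin (diagonalProblem d).B)
      = Matrix.toEuclideanLin (diagonalProblem d).B := by
  rw [← Matrix.toEuclideanLin_conjTranspose_eq_adjoint]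
  simp [diagonalProblem]

lemma spectralBounds_diagonalProblem {n : ℕ} {d : Fin n → ℝ} {m M : ℝ}
    (hd : ∀ j, d j ^ 2 ∈ Set.Icc m M) : (diagonalProblem d).SpectralBounds m M := by
  intro i hi
  have hlt : i < Module.finrank ℝ (EuclideanSpace ℝ (Fin n)) := by
    by_contra h
    exact hi (LinearMap.singularValues_of_finrank_le _ (not_lt.1 h))
  obtain ⟨v, hv⟩ := (LinearMap.hasEigenvalue_adjoint_comp_self_sq_singularValues
    (Matrix.toEuclideanLin (diagonalProblem d).B) hlt).exists_hasEigenvector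
  have hv1 := hv.apply_eq_smul
  rw [adjoint_toEuclideanLin_diagonalProblem] at hv1
  obtain ⟨j, hj⟩ : ∃ j, v j ≠ 0 := by
    by_contra! h
    exact hv.2 (PiLp.ext h)
  have := congrArg (fun x : EuclideanSpace ℝ (Fin n) => x j) hv1
  simp only [LinearMap.comp_apply, toEuclideanLin_diagonalProblem_apply, PiLp.smul_apply,
    smul_eq_mul] at this
  rw [← mul_assoc, ← sq] at this
  have hsq : d j ^ 2 = (Matrix.toEuclideanLin (diagonalProblem d).B).singularValues i ^ 2 :=
    mul_right_cancel₀ hj this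
  exact hsq ▸ hd j

lemma eq_zero_of_isSaddlePoint_diagonalProblem {n : ℕ} {d : Fin n → ℝ} (hd : ∀ j, d j ≠ 0)
    {zs : Z n n} (h : IsSaddlePoint (diagonalProblem d).objective zs) : zs = 0 := by
  obtain ⟨hx, hy⟩ := (isSaddlePoint_iff _).1 h
  rw [adjoint_toEuclideanLin_diagonalProblem] at hx
  have key : ∀ x : EuclideanSpace ℝ (Fin n),
      Matrix.toEuclideanLin (diagonalProblem d).B (x - 0) = 0 → x = 0 := by
    intro x hx
    refine PiLp.ext fun j => ?_
    have := congrArg (fun x : EuclideanSpace ℝ (Fin n) => x j) hx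
    simp only [toEuclideanLin_diagonalProblem_apply, sub_zero, PiLp.zero_apply] at this
    exact (mul_eq_zero.1 this).resolve_left (hd j)
  rw [← norm_eq_zero, ← sq_eq_zero_iff, WithLp.prod_norm_sq_eq_of_L2, key _ hx, key _ hy]
  simp

/-- The vector with coordinates `c j * g (d j ^ 2)`, as a linear function of the polynomial `g`. -/
noncomputable def evalVector {n : ℕ} (d c : Fin n → ℝ) :
    Polynomial ℝ →ₗ[ℝ] EuclideanSpace ℝ (Fin n) where
  toFun g := WithLp.toLp 2 fun j => c j * g.eval (d j ^ 2)
  map_add' g g' := by ext j; simp [mul_add]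
  map_smul' r g := by ext j; simp [mul_left_comm]

lemma evalVector_apply {n : ℕ} (d c : Fin n → ℝ) (g : Polynomial ℝ) (j : Fin n) :
    evalVector d c g j = c j * g.eval (d j ^ 2) := rfl

/-- Started at `x₀ = (1, …, 1)`, `y₀ = 0`, a Krylov sequence of `diag(d)` has
`x_t = p (d ^ 2) x₀` for a polynomial `p = 1 + l * g` of degree at most `t / 2`, since every
gradient exchanges the two blocks and only two exchanges raise the degree in `d ^ 2`. -/
lemma mem_map_evalVector_of_isKrylovSequence {n : ℕ} (d : Fin n → ℝ) {z : ℕ → Z n n}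
    (hz : IsKrylovSequence (diagonalProblem d).objective z)
    (hz0 : z 0 = WithLp.toLp 2 (WithLp.toLp 2 fun _ => 1, 0)) (t : ℕ) :
    (z t).fst - (z 0).fst ∈
        (Polynomial.degreeLT ℝ (t / 2)).map (evalVector d fun j => d j ^ 2) ∧
      (z t).snd ∈ (Polynomial.degreeLT ℝ ((t + 1) / 2)).map (evalVector d d) := by
  induction t using Nat.strong_induction_on with
  | _ t ih =>
    obtain ⟨hx, hy⟩ := hz t
    have hsnd0 : (z 0).snd = 0 := by rw [hz0]; rfl
    rw [hsnd0, sub_zero] at hy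
    have hfst0 : ∀ j, (z 0).fst j = 1 := fun j => by rw [hz0]; rfl
    refine ⟨Submodule.span_le.2 ?_ hx, Submodule.span_le.2 ?_ hy⟩
    · rintro _ ⟨s, hs, rfl⟩
      have hs : s < t := hs
      obtain ⟨g, hg, hgz⟩ := (ih s hs).2
      refine ⟨g, Polynomial.degreeLT_mono (by omega) hg, PiLp.ext fun j => ?_⟩
      simp only
      rw [gradX_objective, toEuclideanLin_diagonalProblem_apply, ← hgz]
      simp only [diagonalProblem, sub_zero, evalVector_apply]
      ring
    · rintro _ ⟨s, hs, rfl⟩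
      have hs : s < t := hs
      obtain ⟨g, hg, hgz⟩ := (ih s hs).1
      have hg' : 1 + Polynomial.X * g ∈ Polynomial.degreeLT ℝ ((t + 1) / 2) := by
        rw [SetLike.mem_coe, Polynomial.mem_degreeLT] at hg
        rw [Polynomial.mem_degreeLT]
        have h2 : ((s / 2 : ℕ) : WithBot ℕ) + 1 ≤ ((t + 1) / 2 : ℕ) := by
          norm_cast
          omega
        refine (Polynomial.degree_add_le _ _).trans_lt (max_lt ?_ ?_)
        · refine (Polynomial.degree_one_le).trans_lt ?_
          norm_cast
          omega
        · rw [mul_comm, Polynomial.degree_mul, Polynomial.degree_X]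
          refine lt_of_lt_of_le ?_ h2
          exact WithBot.add_lt_add_right (by simp) hg
      refine ⟨_, hg', PiLp.ext fun j => ?_⟩
      simp only
      have hj : (z s).fst j = 1 + d j ^ 2 * g.eval (d j ^ 2) := by
        have := congrArg (fun x : EuclideanSpace ℝ (Fin n) => x j) hgz
        simp only [evalVector_apply, PiLp.sub_apply, hfst0] at this
        linarith
      rw [gradY_objective, adjoint_toEuclideanLin_diagonalProblem,
        toEuclideanLin_diagonalProblem_apply]
      simp [diagonalProblem, evalVector_apply, hj, mul_add]

/-- On `diag(√l_j)`, with `l_j` the images of the roots of unity of order `2 T + 1`, the distance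
to the unique saddle point is a quadratic mean of a residual polynomial of degree at most `T`. -/
theorem pow_mul_one_sub_le_of_hasRate {a b : ℝ} (ha : 0 < a) (hb : 0 ≤ b) (hab : b < a)
    {A : ℕ → BilinearMethod} {c : ℕ → ℝ} (hA : ∀ T, IsKrylovMethod (A T))
    (hc : HasRate A ((a - b) ^ 2) ((a + b) ^ 2) c) (T : ℕ) :
    (b / a) ^ T * (1 - b / a) ≤ c T := by
  set N := 2 * T + 1 with hN
  set l : ℕ → ℝ := fun j => spectralPoint a b (2 * π * j / N) with hl
  set d : Fin N → ℝ := fun j => √(l j) with hd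
  have hlmem : ∀ j, l j ∈ Set.Icc ((a - b) ^ 2) ((a + b) ^ 2) :=
    fun j => spectralPoint_mem ha.le hb _
  have hlpos : ∀ j, 0 < l j := fun j => (pow_pos (sub_pos.2 hab) 2).trans_le (hlmem j).1
  have hdsq : ∀ j, d j ^ 2 = l j := fun j => sq_sqrt (hlpos j).le
  set z₀ : Z N N := WithLp.toLp 2 (WithLp.toLp 2 fun _ => 1, 0) with hz₀
  obtain ⟨zs, hzs, hle⟩ := hc T N N (diagonalProblem d)
    (spectralBounds_diagonalProblem fun j => by rw [hdsq]; exact hlmem j) z₀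
  rw [eq_zero_of_isSaddlePoint_diagonalProblem (fun j => (sqrt_pos.2 (hlpos j)).ne') hzs, sub_zero,
    sub_zero] at hle
  obtain ⟨h0, hK⟩ := hA T N N (diagonalProblem d) z₀
  set z := A T N N (diagonalProblem d) z₀ with hz
  obtain ⟨g, hg, hgz⟩ := (mem_map_evalVector_of_isKrylovSequence d hK h0 (2 * T)).1
  rw [Nat.mul_div_cancel_left T two_pos] at hg
  have hp : (1 + Polynomial.X * g).natDegree ≤ T := by
    rcases eq_or_ne g 0 with rfl | hg0
    · simp
    · have : g.natDegree < T :=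
        (Polynomial.natDegree_lt_iff_degree_lt hg0).2 (Polynomial.mem_degreeLT.1 hg)
      refine (Polynomial.natDegree_add_le _ _).trans (max_le (by simp) ?_)
      rw [Polynomial.natDegree_X_mul hg0]
      omega
  have key := pow_mul_one_sub_le_average ha hb hab (N := N) (by omega) hp (by simp)
  have hcoord : ∀ j : Fin N, (z (2 * T)).fst j = (1 + Polynomial.X * g).eval (l j) := by
    intro j
    have := congrArg (fun x : EuclideanSpace ℝ (Fin N) => x j) hgz
    simp only [evalVector_apply, PiLp.sub_apply, h0, hdsq] at this
    have h1 : z₀.fst j = 1 := rfl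
    rw [h1] at this
    simp only [Polynomial.eval_add, Polynomial.eval_one, Polynomial.eval_mul, Polynomial.eval_X]
    linarith
  have hNpos : (0 : ℝ) < N := by positivity
  have hz₀norm : ‖z₀‖ = √N := by
    rw [← sqrt_sq (norm_nonneg z₀), WithLp.prod_norm_sq_eq_of_L2, EuclideanSpace.norm_sq_eq]
    simp [hz₀]
  have hfst : ‖(z (2 * T)).fst‖ ≤ ‖z (2 * T)‖ := by
    refine le_of_sq_le_sq ?_ (norm_nonneg _)
    rw [WithLp.prod_norm_sq_eq_of_L2]
    linarith [sq_nonneg ‖(z (2 * T)).snd‖]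
  have hCS : ∑ j ∈ Finset.range N, |(1 + Polynomial.X * g).eval (l j)|
      ≤ √N * ‖(z (2 * T)).fst‖ := by
    rw [Finset.sum_range]
    refine le_of_sq_le_sq ?_ (by positivity)
    rw [mul_pow, sq_sqrt hNpos.le, EuclideanSpace.norm_sq_eq]
    refine sq_sum_le_card_mul_sum_sq.trans (le_of_eq ?_)
    simp [hcoord]
  refine key.trans ((div_le_iff₀ hNpos).2 (hCS.trans ?_))
  calc √N * ‖(z (2 * T)).fst‖ ≤ √N * (c T * √N) := by
        rw [← hz₀norm]
        exact mul_le_mul_of_nonneg_left (hfst.trans hle) (norm_nonneg _)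
    _ = c T * (√N * √N) := by ring
    _ = c T * N := by rw [mul_self_sqrt hNpos.le]

end Slingshot

namespace Slingshot

/-! ### Logarithmic potential of the arcsine distribution -/

lemma integral_arcsineMeasure {a b : ℝ} (ha : 0 < a) (hb : 0 < b) (f : ℝ → ℝ) :
    ∫ r, f r ∂(arcsineMeasure ((a - b) ^ 2) ((a + b) ^ 2))
      = π⁻¹ * ∫ θ in 0..π, f (spectralPoint a b θ) := by
  have hab : 0 < a * b := mul_pos ha hb
  have hlt : (a - b) ^ 2 < (a + b) ^ 2 := by nlinarith
  have hmeas : Measurable fun z : ℝ => ENNReal.ofReal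
      ((Set.Ioo ((a - b) ^ 2) ((a + b) ^ 2)).indicator
        (fun z => 1 / (π * √(((a + b) ^ 2 - z) * (z - (a - b) ^ 2)))) z) := by
    refine ENNReal.measurable_ofReal.comp (Measurable.indicator ?_ measurableSet_Ioo)
    fun_prop
  rw [arcsineMeasure, if_pos hlt, integral_withDensity_eq_integral_toReal_smul hmeas
    (ae_of_all _ fun _ => ENNReal.ofReal_lt_top)]
  have h1 : ∀ z, (ENNReal.ofReal ((Set.Ioo ((a - b) ^ 2) ((a + b) ^ 2)).indicator
        (fun z => 1 / (π * √(((a + b) ^ 2 - z) * (z - (a - b) ^ 2)))) z)).toReal • f z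
      = (Set.Ioo ((a - b) ^ 2) ((a + b) ^ 2)).indicator
        (fun z => 1 / (π * √(((a + b) ^ 2 - z) * (z - (a - b) ^ 2))) * f z) z := by
    intro z
    rw [ENNReal.toReal_ofReal (Set.indicator_nonneg (fun _ _ => by positivity) z), smul_eq_mul,
      Set.indicator_mul_left]
  simp_rw [h1]
  rw [integral_indicator measurableSet_Ioo, ← integral_Ioc_eq_integral_Ioo,
    ← intervalIntegral.integral_of_le hlt.le,
    show (a - b) ^ 2 = 2 * a * b * (-1) + (a ^ 2 + b ^ 2) by ring,
    show (a + b) ^ 2 = 2 * a * b * 1 + (a ^ 2 + b ^ 2) by ring,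
    ← intervalIntegral.smul_integral_comp_mul_add, smul_eq_mul,
    ← intervalIntegral.integral_const_mul, ← intervalIntegral.integral_const_mul]
  have h2 := Polynomial.Chebyshev.integral_measureT_eq_integral_cos
    (f := fun x => π⁻¹ * f (2 * a * b * x + (a ^ 2 + b ^ 2)))
  rw [Polynomial.Chebyshev.integral_measureT] at h2
  simp only [spectralPoint, add_comm (a ^ 2 + b ^ 2)]
  rw [← h2]
  congr 1 with x
  have h3 : (2 * a * b * 1 + (a ^ 2 + b ^ 2) - (2 * a * b * x + (a ^ 2 + b ^ 2))) *
      (2 * a * b * x + (a ^ 2 + b ^ 2) - (2 * a * b * (-1) + (a ^ 2 + b ^ 2)))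
      = (2 * (a * b)) ^ 2 * (1 - x ^ 2) := by ring
  rw [h3, sqrt_mul (by positivity), sqrt_sq (by positivity), sqrt_inv]
  field_simp

lemma ae_arcsineMeasure_mem_Ioo {m M : ℝ} (h : m < M) :
    ∀ᵐ r ∂(arcsineMeasure m M), r ∈ Set.Ioo m M := by
  rw [arcsineMeasure, if_pos h, ae_withDensity_iff]
  · refine ae_of_all _ fun r hr => ?_
    by_contra hn
    simp [Set.indicator_of_notMem hn] at hr
  · refine ENNReal.measurable_ofReal.comp (Measurable.indicator ?_ measurableSet_Ioo)
    fun_prop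

lemma integral_log_norm_exp_sub {u : ℂ} (hu : 1 < ‖u‖) :
    ∫ θ in 0..(2 * π), log ‖Complex.exp (θ * Complex.I) - u‖ = 2 * π * log ‖u‖ := by
  have h := circleAverage_log_norm_sub_const₂ hu
  rw [circleAverage_def, smul_eq_mul, inv_mul_eq_iff_eq_mul₀ (by positivity)] at h
  rw [← h]
  simp [circleMap]

lemma exp_sub_ne_zero {u : ℂ} (hu : 1 < ‖u‖) (θ : ℝ) : Complex.exp (θ * Complex.I) - u ≠ 0 := by
  intro h
  rw [sub_eq_zero] at h
  rw [← h, Complex.norm_exp_ofReal_mul_I] at hu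
  exact lt_irrefl _ hu

lemma intervalIntegrable_log_norm_exp_sub {u : ℂ} (hu : 1 < ‖u‖) (s t : ℝ) :
    IntervalIntegrable (fun θ : ℝ => log ‖Complex.exp (θ * Complex.I) - u‖) volume s t := by
  refine Continuous.intervalIntegrable (Continuous.log (by fun_prop) fun θ => ?_) _ _
  exact norm_ne_zero_iff.2 (exp_sub_ne_zero hu θ)

lemma integral_zero_pi_of_cos (F : ℝ → ℝ)
    (hF : IntervalIntegrable (fun θ => F (cos θ)) volume 0 (2 * π)) :
    ∫ θ in 0..π, F (cos θ) = (∫ θ in 0..(2 * π), F (cos θ)) / 2 := by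
  have hs : ∫ θ in π..(2 * π), F (cos θ) = ∫ θ in 0..π, F (cos θ) := by
    have := intervalIntegral.integral_comp_sub_left (a := π) (b := 2 * π)
      (fun θ => F (cos θ)) (2 * π)
    simp only [cos_two_pi_sub, sub_self] at this
    rw [this]
    congr 1
    ring
  have hpi : π ∈ Set.uIcc 0 (2 * π) := by
    rw [Set.uIcc_of_le two_pi_pos.le]
    exact ⟨pi_pos.le, by linarith [pi_pos]⟩
  rw [← intervalIntegral.integral_add_adjacent_intervals (b := π)
    (hF.mono_set (Set.uIcc_subset_uIcc_left hpi)) (hF.mono_set (Set.uIcc_subset_uIcc_right hpi)), hs]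
  ring

/-- For `x = cos θ`, `y = cos φ` this is `|e^{iθ} - R e^{iφ}| ^ 2 * |e^{iθ} - R e^{-iφ}| ^ 2`. At
`R = 1` it is `4 * (x - y) ^ 2`; for `R > 1` it is a positive majorant of it. -/
noncomputable def smoothedSq (R x y : ℝ) : ℝ :=
  4 * R ^ 2 * x ^ 2 - 4 * R * (1 + R ^ 2) * (x * y) + 4 * R ^ 2 * y ^ 2 + (R ^ 2 - 1) ^ 2

lemma four_mul_sq_add_le_smoothedSq {R x y : ℝ} (hR : 1 < R) (hx : x ∈ Set.Icc (-1) 1)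
    (hy : y ∈ Set.Icc (-1) 1) : 4 * (x - y) ^ 2 + (R - 1) ^ 4 ≤ smoothedSq R x y := by
  have hxy : x * y ≤ 1 := by
    nlinarith [sq_nonneg (x - y), mul_nonneg (neg_le_iff_add_nonneg.1 hx.1) (sub_nonneg.2 hx.2),
      mul_nonneg (neg_le_iff_add_nonneg.1 hy.1) (sub_nonneg.2 hy.2)]
  have h0 : 0 < R - 1 := sub_pos.2 hR
  have h1 : 0 ≤ (R - 1) * (4 * (R + 1) * (x - y) ^ 2) := by positivity
  have h2 : 0 ≤ (R - 1) * (4 * R * (R - 1) * (1 - x * y)) := by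
    have : 0 ≤ 1 - x * y := sub_nonneg.2 hxy
    positivity
  unfold smoothedSq
  linarith

lemma norm_sq_exp_sub (R θ φ : ℝ) : ‖Complex.exp (θ * Complex.I) - R * Complex.exp (φ * Complex.I)‖
    ^ 2 = 1 + R ^ 2 - 2 * R * (cos θ * cos φ + sin θ * sin φ) := by
  rw [← Complex.normSq_eq_norm_sq, Complex.normSq_apply]
  simp only [Complex.sub_re, Complex.sub_im, Complex.exp_ofReal_mul_I_re,
    Complex.exp_ofReal_mul_I_im, Complex.re_ofReal_mul, Complex.im_ofReal_mul]
  linear_combination sin_sq_add_cos_sq θ + R ^ 2 * sin_sq_add_cos_sq φ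

lemma log_smoothedSq_cos {R : ℝ} (hR : 1 < R) (θ φ : ℝ) : log (smoothedSq R (cos θ) (cos φ))
    = 2 * log ‖Complex.exp (θ * Complex.I) - R * Complex.exp (φ * Complex.I)‖
      + 2 * log ‖Complex.exp (θ * Complex.I) - R * Complex.exp ((-φ : ℝ) * Complex.I)‖ := by
  have hu : ∀ φ : ℝ, 1 < ‖(R : ℂ) * Complex.exp (φ * Complex.I)‖ := fun φ => by
    rw [norm_mul, Complex.norm_exp_ofReal_mul_I, mul_one, Complex.norm_real, Real.norm_eq_abs]
    exact hR.trans_le (le_abs_self R)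
  have hprod : smoothedSq R (cos θ) (cos φ)
      = ‖Complex.exp (θ * Complex.I) - R * Complex.exp (φ * Complex.I)‖ ^ 2
        * ‖Complex.exp (θ * Complex.I) - R * Complex.exp ((-φ : ℝ) * Complex.I)‖ ^ 2 := by
    rw [norm_sq_exp_sub, norm_sq_exp_sub, cos_neg, sin_neg, smoothedSq]
    linear_combination (4 * R ^ 2 * sin φ ^ 2) * sin_sq θ + (4 * R ^ 2 * (1 - cos θ ^ 2)) * sin_sq φ
  rw [hprod, log_mul, log_pow, log_pow]
  · norm_num
  · exact pow_ne_zero _ (norm_ne_zero_iff.2 (exp_sub_ne_zero (hu φ) θ))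
  · exact pow_ne_zero _ (norm_ne_zero_iff.2 (exp_sub_ne_zero (hu (-φ)) θ))

/-- The mean does not depend on `φ`, because `log |w - u|` is harmonic in `w` on the unit disc
for `|u| = R > 1`, with the value `log R` at the center. -/
lemma integral_log_smoothedSq {R : ℝ} (hR : 1 < R) (φ : ℝ) :
    ∫ θ in 0..π, log (smoothedSq R (cos θ) (cos φ)) = π * (4 * log R) := by
  have hn : ∀ φ : ℝ, ‖(R : ℂ) * Complex.exp (φ * Complex.I)‖ = R := fun φ => by
    rw [norm_mul, Complex.norm_exp_ofReal_mul_I, mul_one, Complex.norm_real, Real.norm_eq_abs,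
      abs_of_pos (by linarith)]
  have hu : ∀ φ : ℝ, 1 < ‖(R : ℂ) * Complex.exp (φ * Complex.I)‖ := fun φ => by rwa [hn]
  have hi := fun φ : ℝ => (intervalIntegrable_log_norm_exp_sub (hu φ) 0 (2 * π)).const_mul 2
  rw [integral_zero_pi_of_cos (fun x => log (smoothedSq R x (cos φ)))]
  · simp_rw [log_smoothedSq_cos hR]
    rw [intervalIntegral.integral_add (hi φ) (hi (-φ)), intervalIntegral.integral_const_mul,
      intervalIntegral.integral_const_mul, integral_log_norm_exp_sub (hu _),
      integral_log_norm_exp_sub (hu _), hn, hn]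
    ring
  · simp_rw [log_smoothedSq_cos hR]
    exact (hi φ).add (hi (-φ))

lemma spectralPoint_eq_norm_sq {a b : ℝ} (hb : b ≠ 0) (θ : ℝ) : spectralPoint a b θ
    = b ^ 2 * ‖Complex.exp (θ * Complex.I) - ((-(a / b) : ℝ) : ℂ)‖ ^ 2 := by
  have := norm_sq_exp_sub (-(a / b)) θ 0
  simp only [Complex.ofReal_zero, zero_mul, Complex.exp_zero, mul_one, cos_zero, sin_zero, mul_zero,
    add_zero] at this
  rw [this, spectralPoint]
  field_simp
  ring

lemma log_spectralPoint {a b : ℝ} (hb : 0 < b) (hab : b < a) (θ : ℝ) :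
    log (spectralPoint a b θ)
      = 2 * log b + 2 * log ‖Complex.exp (θ * Complex.I) - ((-(a / b) : ℝ) : ℂ)‖ := by
  have hu : 1 < ‖((-(a / b) : ℝ) : ℂ)‖ := by
    rw [Complex.norm_real, norm_neg]
    exact ((one_lt_div hb).2 hab).trans_le (le_abs_self _)
  rw [spectralPoint_eq_norm_sq hb.ne', log_mul (by positivity)
    (pow_ne_zero _ (norm_ne_zero_iff.2 (exp_sub_ne_zero hu θ))), log_pow, log_pow]
  norm_num

lemma intervalIntegrable_log_spectralPoint {a b : ℝ} (hb : 0 < b) (hab : b < a) (s t : ℝ) :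
    IntervalIntegrable (fun θ => log (spectralPoint a b θ)) volume s t := by
  refine Continuous.intervalIntegrable (Continuous.log ?_ fun θ => ?_) _ _
  · unfold spectralPoint
    fun_prop
  · exact ((pow_pos (sub_pos.2 hab) 2).trans_le (spectralPoint_mem (hb.trans hab).le hb.le θ).1).ne'

lemma integral_log_spectralPoint {a b : ℝ} (hb : 0 < b) (hab : b < a) :
    ∫ θ in 0..π, log (spectralPoint a b θ) = π * (2 * log a) := by
  have ha : 0 < a := hb.trans hab
  have hn : ‖((-(a / b) : ℝ) : ℂ)‖ = a / b := by
    rw [Complex.norm_real, norm_neg, Real.norm_of_nonneg (by positivity)]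
  have hu : 1 < ‖((-(a / b) : ℝ) : ℂ)‖ := by rw [hn]; exact (one_lt_div hb).2 hab
  have h := integral_zero_pi_of_cos (fun x => log (a ^ 2 + b ^ 2 + 2 * a * b * x))
    (intervalIntegrable_log_spectralPoint hb hab 0 (2 * π))
  refine h.trans ?_
  have h2 : ∀ θ, log (a ^ 2 + b ^ 2 + 2 * a * b * cos θ)
      = 2 * log b + 2 * log ‖Complex.exp (θ * Complex.I) - ((-(a / b) : ℝ) : ℂ)‖ :=
    log_spectralPoint hb hab
  simp_rw [h2]
  rw [intervalIntegral.integral_add intervalIntegrable_const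
    ((intervalIntegrable_log_norm_exp_sub hu _ _).const_mul 2),
    intervalIntegral.integral_const_mul, intervalIntegral.integral_const_mul,
    integral_log_norm_exp_sub hu, hn,
    log_div ha.ne' hb.ne', intervalIntegral.integral_const, smul_eq_mul]
  ring

/-- The position of `l ∈ [(a - b) ^ 2, (a + b) ^ 2]` after rescaling the interval to `[-1, 1]`. -/
noncomputable def rescale (a b l : ℝ) : ℝ := (l - (a ^ 2 + b ^ 2)) / (2 * a * b)

lemma rescale_mem {a b l : ℝ} (ha : 0 < a) (hb : 0 < b)
    (hl : l ∈ Set.Icc ((a - b) ^ 2) ((a + b) ^ 2)) : rescale a b l ∈ Set.Icc (-1) 1 := by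
  obtain ⟨h1, h2⟩ := hl
  have h : 0 < 2 * a * b := by positivity
  constructor
  · rw [rescale, le_div_iff₀ h]
    linarith
  · rw [rescale, div_le_iff₀ h]
    linarith

lemma rescale_spectralPoint {a b : ℝ} (ha : 0 < a) (hb : 0 < b) (θ : ℝ) :
    rescale a b (spectralPoint a b θ) = cos θ := by
  rw [rescale, spectralPoint]
  field_simp
  ring

/-- A continuous majorant of `log |1 - l / r|`, obtained by moving `l` off the interval. -/
noncomputable def smoothedLog (a b R l r : ℝ) : ℝ :=
  log (smoothedSq R (rescale a b r) (rescale a b l)) / 2 + log (a * b) - log r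

lemma smoothedSq_rescale_pos {a b R l r : ℝ} (ha : 0 < a) (hb : 0 < b) (hR : 1 < R)
    (hl : l ∈ Set.Icc ((a - b) ^ 2) ((a + b) ^ 2)) (hr : r ∈ Set.Icc ((a - b) ^ 2) ((a + b) ^ 2)) :
    0 < smoothedSq R (rescale a b r) (rescale a b l) := by
  have := four_mul_sq_add_le_smoothedSq hR (rescale_mem ha hb hr) (rescale_mem ha hb hl)
  have h2 : 0 < (R - 1) ^ 4 := pow_pos (sub_pos.2 hR) 4
  nlinarith [sq_nonneg (rescale a b r - rescale a b l)]

lemma abs_one_sub_le_exp_smoothedLog {a b R l r : ℝ} (hb : 0 < b) (hab : b < a) (hR : 1 < R)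
    (hl : l ∈ Set.Icc ((a - b) ^ 2) ((a + b) ^ 2)) (hr : r ∈ Set.Icc ((a - b) ^ 2) ((a + b) ^ 2)) :
    |1 - l / r| ≤ exp (smoothedLog a b R l r) := by
  have ha : 0 < a := hb.trans hab
  have hr0 : 0 < r := (pow_pos (sub_pos.2 hab) 2).trans_le hr.1
  have hpos := smoothedSq_rescale_pos ha hb hR hl hr
  have hle := four_mul_sq_add_le_smoothedSq hR (rescale_mem ha hb hr) (rescale_mem ha hb hl)
  have h2 : 0 < (R - 1) ^ 4 := pow_pos (sub_pos.2 hR) 4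
  rw [smoothedLog, exp_sub, exp_add, exp_log hr0, exp_log (by positivity), ← log_sqrt hpos.le,
    exp_log (sqrt_pos.2 hpos), le_div_iff₀ hr0]
  have h3 : |1 - l / r| * r = 2 * |rescale a b r - rescale a b l| * (a * b) := by
    rw [rescale, rescale, ← sub_div, abs_div, abs_of_pos (show 0 < 2 * a * b by positivity),
      sub_sub_sub_cancel_right, one_sub_div hr0.ne', abs_div, abs_of_pos hr0]
    field_simp
  rw [h3]
  refine mul_le_mul_of_nonneg_right (le_sqrt_of_sq_le ?_) (by positivity)
  rw [mul_pow, sq_abs]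
  linarith

lemma measurable_smoothedLog (a b R l : ℝ) : Measurable (smoothedLog a b R l) := by
  unfold smoothedLog smoothedSq rescale
  fun_prop

lemma continuousOn_smoothedLog {a b R : ℝ} (hb : 0 < b) (hab : b < a) (hR : 1 < R) :
    ContinuousOn (fun q : ℝ × ℝ => smoothedLog a b R q.1 q.2)
      (Set.Icc ((a - b) ^ 2) ((a + b) ^ 2) ×ˢ Set.Icc ((a - b) ^ 2) ((a + b) ^ 2)) := by
  unfold smoothedLog
  refine ((ContinuousOn.log ?_ fun q hq => ?_).div_const 2 |>.add_const _).sub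
    (ContinuousOn.log continuousOn_snd fun q hq => ?_)
  · refine Continuous.continuousOn ?_
    unfold smoothedSq rescale
    fun_prop
  · exact (smoothedSq_rescale_pos (hb.trans hab) hb hR hq.1 hq.2).ne'
  · exact ((pow_pos (sub_pos.2 hab) 2).trans_le hq.2.1).ne'

lemma integral_smoothedLog {a b R l : ℝ} (hb : 0 < b) (hab : b < a) (hR : 1 < R)
    (hl : l ∈ Set.Icc ((a - b) ^ 2) ((a + b) ^ 2)) :
    ∫ r, smoothedLog a b R l r ∂(arcsineMeasure ((a - b) ^ 2) ((a + b) ^ 2))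
      = log (b / a) + 2 * log R := by
  have ha : 0 < a := hb.trans hab
  rw [integral_arcsineMeasure ha hb]
  obtain ⟨hl1, hl2⟩ := rescale_mem ha hb hl
  have hφ : rescale a b l = cos (arccos (rescale a b l)) := (cos_arccos hl1 hl2).symm
  simp only [smoothedLog, rescale_spectralPoint ha hb]
  have hi : IntervalIntegrable (fun θ => log (smoothedSq R (cos θ) (rescale a b l))) volume 0 π := by
    refine Continuous.intervalIntegrable (Continuous.log ?_ fun θ => ?_) _ _
    · unfold smoothedSq
      fun_prop
    · rw [← rescale_spectralPoint ha hb θ]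
      exact (smoothedSq_rescale_pos ha hb hR hl (spectralPoint_mem ha.le hb.le θ)).ne'
  rw [intervalIntegral.integral_sub ((hi.div_const 2).add intervalIntegrable_const)
    (intervalIntegrable_log_spectralPoint hb hab _ _), intervalIntegral.integral_add
    (hi.div_const 2) intervalIntegrable_const, intervalIntegral.integral_div, hφ,
    integral_log_smoothedSq hR, integral_log_spectralPoint hb hab,
    intervalIntegral.integral_const, smul_eq_mul, log_mul ha.ne' hb.ne', log_div hb.ne' ha.ne']
  field_simp
  ring

end Slingshot

namespace Slingshot

/-! ### A uniform law of large numbers and the random rate -/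

/-- An upper law of large numbers, uniform in the parameter: by uniform continuity of `Φ` the
parameter can be restricted to a finite set. -/
lemma ae_eventually_sum_le_of_integral_le {Ω : Type*} [MeasurableSpace Ω] {μ : Measure Ω}
    [IsProbabilityMeasure μ] {ν : Measure ℝ} {r : ℕ → Ω → ℝ} (hlaw : ∀ t, HasLaw (r t) ν μ)
    (hindep : iIndepFun r μ) {K : Set ℝ} (hK : IsCompact K) (hrK : ∀ᵐ ω ∂μ, ∀ t, r t ω ∈ K)
    {Φ : ℝ → ℝ → ℝ} (hΦm : ∀ l, Measurable (Φ l))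
    (hΦ : ContinuousOn (fun q : ℝ × ℝ => Φ q.1 q.2) (K ×ˢ K)) {E : ℝ}
    (hE : ∀ l ∈ K, ∫ x, Φ l x ∂ν ≤ E) {ε : ℝ} (hε : 0 < ε) :
    ∀ᵐ ω ∂μ, ∀ᶠ T : ℕ in atTop, ∀ l ∈ K,
      ∑ t ∈ Finset.range T, Φ l (r t ω) ≤ T * (E + ε) := by
  have hunif := (hK.prod hK).uniformContinuousOn_of_continuous hΦ
  obtain ⟨δ, hδ, hδΦ⟩ := Metric.uniformContinuousOn_iff.1 hunif (ε / 2) (half_pos hε)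
  obtain ⟨G, hGK, hGfin, hGcover⟩ := hK.finite_cover_balls hδ
  obtain ⟨D, hD⟩ := (hK.prod hK).exists_bound_of_continuousOn hΦ
  have hslln : ∀ l ∈ K, ∀ᵐ ω ∂μ, ∀ᶠ T : ℕ in atTop,
      ∑ t ∈ Finset.range T, Φ l (r t ω) ≤ T * (E + ε / 2) := by
    intro l hl
    have hint : Integrable (fun ω => Φ l (r 0 ω)) μ := by
      refine Integrable.of_bound
        ((hΦm l).comp_aemeasurable (hlaw 0).aemeasurable).aestronglyMeasurable D ?_
      filter_upwards [hrK] with ω hω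
      exact hD (l, r 0 ω) ⟨hl, hω 0⟩
    have h := strong_law_ae_real (fun t ω => Φ l (r t ω)) hint
      (fun i j hij => (hindep.indepFun hij).comp (hΦm l) (hΦm l))
      (fun t => IdentDistrib.comp ⟨(hlaw t).aemeasurable, (hlaw 0).aemeasurable,
        (hlaw t).map_eq.trans (hlaw 0).map_eq.symm⟩ (hΦm l))
    have hmean : ∫ ω, Φ l (r 0 ω) ∂μ < E + ε / 2 := by
      have := (hlaw 0).integral_comp (f := Φ l) (hΦm l).aestronglyMeasurable
      rw [Function.comp_def] at this
      rw [this]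
      linarith [hE l hl]
    filter_upwards [h] with ω hω
    filter_upwards [hω.eventually_lt_const hmean, eventually_gt_atTop 0] with T hT hT0
    have hT0' : (0 : ℝ) < T := Nat.cast_pos.2 hT0
    rw [div_lt_iff₀ hT0'] at hT
    linarith
  have hall : ∀ᵐ ω ∂μ, ∀ l ∈ G, ∀ᶠ T : ℕ in atTop,
      ∑ t ∈ Finset.range T, Φ l (r t ω) ≤ T * (E + ε / 2) :=
    (ae_ball_iff hGfin.countable).2 fun l hl => hslln l (hGK hl)
  filter_upwards [hall, hrK] with ω hω hωK
  filter_upwards [(hGfin.eventually_all).2 hω] with T hT l hl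
  obtain ⟨g, hg, hlg⟩ := Set.mem_iUnion₂.1 (hGcover hl)
  have hdiff : ∀ t ∈ Finset.range T, Φ l (r t ω) ≤ Φ g (r t ω) + ε / 2 := by
    intro t _
    have := hδΦ (l, r t ω) ⟨hl, hωK t⟩ (g, r t ω) ⟨hGK hg, hωK t⟩ (by
      rw [Prod.dist_eq, dist_self]
      exact max_lt (Metric.mem_ball.1 hlg) hδ)
    linarith [(abs_lt.1 (Real.dist_eq _ _ ▸ this)).2]
  calc ∑ t ∈ Finset.range T, Φ l (r t ω)
      ≤ ∑ t ∈ Finset.range T, (Φ g (r t ω) + ε / 2) := Finset.sum_le_sum hdiff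
    _ = ∑ t ∈ Finset.range T, Φ g (r t ω) + T * (ε / 2) := by
        rw [Finset.sum_add_distrib]
        simp
    _ ≤ T * (E + ε / 2) + T * (ε / 2) := by linarith [hT g hg]
    _ = T * (E + ε) := by ring

/-- The largest absolute value on `K` of the residual polynomial of the stepsizes
`h 0, …, h (T - 1)`. -/
noncomputable def residualSup (K : Set ℝ) (T : ℕ) (h : ℕ → ℝ) : ℝ :=
  sSup ((fun l => |∏ t ∈ Finset.range T, (1 - h t ^ 2 * l)|) '' K)

lemma continuous_residualSup {K : Set ℝ} (hK : IsCompact K) (T : ℕ) :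
    Continuous (residualSup K T) := by
  refine hK.continuous_sSup (f := fun (h : ℕ → ℝ) l => |∏ t ∈ Finset.range T, (1 - h t ^ 2 * l)|) ?_
  change Continuous fun q : (ℕ → ℝ) × ℝ => |∏ t ∈ Finset.range T, (1 - q.1 t ^ 2 * q.2)|
  fun_prop

lemma residualSup_nonneg (K : Set ℝ) (T : ℕ) (h : ℕ → ℝ) : 0 ≤ residualSup K T h := by
  refine Real.sSup_nonneg ?_
  rintro _ ⟨l, _, rfl⟩
  exact abs_nonneg _

lemma le_residualSup {K : Set ℝ} (hK : IsCompact K) (T : ℕ) (h : ℕ → ℝ) {l : ℝ} (hl : l ∈ K) :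
    |∏ t ∈ Finset.range T, (1 - h t ^ 2 * l)| ≤ residualSup K T h := by
  refine le_csSup (hK.image ?_).bddAbove (Set.mem_image_of_mem _ hl)
  fun_prop

lemma pow_mul_one_sub_le_residualSup {a b : ℝ} (ha : 0 < a) (hb : 0 ≤ b) (hab : b < a) (T : ℕ)
    (h : ℕ → ℝ) : (b / a) ^ T * (1 - b / a)
      ≤ residualSup (Set.Icc ((a - b) ^ 2) ((a + b) ^ 2)) T h := by
  set p : Polynomial ℝ := ∏ t ∈ Finset.range T, (Polynomial.C (-h t ^ 2) * Polynomial.X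
    + Polynomial.C 1) with hp
  have heval : ∀ x, p.eval x = ∏ t ∈ Finset.range T, (1 - h t ^ 2 * x) := fun x => by
    rw [hp, Polynomial.eval_prod]
    refine Finset.prod_congr rfl fun t _ => ?_
    simp
    ring
  have hdeg : p.natDegree ≤ T := by
    refine (Polynomial.natDegree_prod_le _ _).trans ?_
    refine (Finset.sum_le_sum fun t _ => Polynomial.natDegree_linear_le).trans ?_
    simp
  have hp0 : p.coeff 0 = 1 := by
    rw [Polynomial.coeff_zero_eq_eval_zero, heval]
    simp
  refine (pow_mul_one_sub_le_average ha hb hab (Nat.lt_succ_self (2 * T)) hdeg hp0).trans ?_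
  rw [div_le_iff₀ (by positivity)]
  refine (Finset.sum_le_card_nsmul _ _
    (residualSup (Set.Icc ((a - b) ^ 2) ((a + b) ^ 2)) T h) fun j _ => ?_).trans (le_of_eq ?_)
  · rw [heval]
    exact le_residualSup isCompact_Icc T h (spectralPoint_mem ha.le hb _)
  · rw [Finset.card_range, nsmul_eq_mul, mul_comm]

section Random

variable {Ω : Type*} [MeasurableSpace Ω] {μ : Measure Ω} {a b : ℝ} {r : ℕ → Ω → ℝ}

lemma ae_mem_Icc_of_hasLaw_arcsineMeasure {m M : ℝ} (hmM : m ≤ M)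
    (hlaw : ∀ t, HasLaw (r t) (arcsineMeasure m M) μ) : ∀ᵐ ω ∂μ, ∀ t, r t ω ∈ Set.Icc m M := by
  refine ae_all_iff.2 fun t => ?_
  rcases hmM.lt_or_eq with h | rfl
  · refine ((hlaw t).ae_iff measurableSet_Icc.mem).2 ?_
    filter_upwards [ae_arcsineMeasure_mem_Ioo h] with x hx
    exact Set.Ioo_subset_Icc_self hx
  · have h := hlaw t
    rw [arcsineMeasure, if_neg (lt_irrefl _)] at h
    filter_upwards [h.ae_eq_of_dirac] with ω hω
    simp [hω]

lemma ae_eventually_residualSup_le [IsProbabilityMeasure μ] (ha : 0 < a) (hb : 0 ≤ b) (hab : b < a)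
    (hlaw : ∀ t, HasLaw (r t) (arcsineMeasure ((a - b) ^ 2) ((a + b) ^ 2)) μ)
    (hindep : iIndepFun r μ) {q : ℝ} (hq : b / a < q) :
    ∀ᵐ ω ∂μ, ∀ᶠ T : ℕ in atTop, residualSup (Set.Icc ((a - b) ^ 2) ((a + b) ^ 2)) T
      (fun t => 1 / √(r t ω)) ≤ q ^ T := by
  have hlo : 0 < (a - b) ^ 2 := pow_pos (sub_pos.2 hab) 2
  have hle : (a - b) ^ 2 ≤ (a + b) ^ 2 := by nlinarith
  have hq0 : 0 < q := lt_of_le_of_lt (by positivity) hq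
  have hmem := ae_mem_Icc_of_hasLaw_arcsineMeasure hle hlaw
  have hne : (Set.Icc ((a - b) ^ 2) ((a + b) ^ 2)).Nonempty := Set.nonempty_Icc.2 hle
  have hsq : ∀ x ∈ Set.Icc ((a - b) ^ 2) ((a + b) ^ 2), ∀ l, 1 - (1 / √x) ^ 2 * l = 1 - l / x := by
    intro x hx l
    rw [div_pow, sq_sqrt (hlo.le.trans hx.1), one_pow, one_div_mul_eq_div]
  rcases hb.eq_or_lt with rfl | hb
  · -- the interval is a point, and one double step reaches the saddle point
    filter_upwards [hmem] with ω hω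
    filter_upwards [eventually_gt_atTop 0] with T hT
    refine csSup_le (hne.image _) ?_
    rintro _ ⟨l, hl, rfl⟩
    have hl' : l = r 0 ω := by
      have h0 := hω 0
      simp only [sub_zero, add_zero, Set.Icc_self, Set.mem_singleton_iff] at hl h0
      rw [hl, h0]
    simp only
    rw [Finset.prod_eq_zero (Finset.mem_range.2 hT), abs_zero]
    · positivity
    · rw [hsq _ (hω 0), hl', div_self (hlo.trans_le (hω 0).1).ne', sub_self]
  · -- half of the gap `log q - log (b / a)` is spent on the smoothing, the other half on the
    -- law of large numbers
    have hρ : 0 < b / a := by positivity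
    set g : ℝ := log q - log (b / a) with hg
    have hg0 : 0 < g := sub_pos.2 (log_lt_log hρ hq)
    have hR : 1 < exp (g / 4) := one_lt_exp_iff.2 (by positivity)
    have hlln := ae_eventually_sum_le_of_integral_le hlaw hindep isCompact_Icc hmem
      (measurable_smoothedLog a b (exp (g / 4))) (continuousOn_smoothedLog hb hab hR)
      (fun l hl => (integral_smoothedLog hb hab hR hl).le) (half_pos hg0)
    filter_upwards [hlln, hmem] with ω hω hωK
    filter_upwards [hω] with T hT
    refine csSup_le (hne.image _) ?_
    rintro _ ⟨l, hl, rfl⟩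
    simp only
    rw [Finset.abs_prod]
    calc ∏ t ∈ Finset.range T, |1 - (1 / √(r t ω)) ^ 2 * l|
        ≤ ∏ t ∈ Finset.range T, exp (smoothedLog a b (exp (g / 4)) l (r t ω)) := by
          refine Finset.prod_le_prod (fun _ _ => abs_nonneg _) fun t _ => ?_
          rw [hsq _ (hωK t)]
          exact abs_one_sub_le_exp_smoothedLog hb hab hR hl (hωK t)
      _ = exp (∑ t ∈ Finset.range T, smoothedLog a b (exp (g / 4)) l (r t ω)) :=
          (exp_sum _ _).symm
      _ ≤ exp (T * log q) := by
          refine exp_le_exp.2 ((hT l hl).trans (le_of_eq ?_))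
          rw [log_exp, hg]
          ring
      _ = q ^ T := by rw [exp_nat_mul, exp_log hq0]

end Random

lemma tendsto_pow_mul_rpow_one_div {ρ c : ℝ} (hρ : 0 ≤ ρ) (hc : 0 < c) :
    Tendsto (fun T : ℕ => (ρ ^ T * c) ^ (1 / (T : ℝ))) atTop (𝓝 ρ) := by
  have h1 : Tendsto (fun T : ℕ => ρ * c ^ (1 / (T : ℝ))) atTop (𝓝 (ρ * c ^ (0 : ℝ))) :=
    ((continuousAt_const_rpow hc.ne').tendsto.comp tendsto_one_div_atTop_nhds_zero_nat).const_mul ρ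
  rw [rpow_zero, mul_one] at h1
  refine h1.congr' ?_
  filter_upwards [eventually_ne_atTop 0] with T hT
  rw [mul_rpow (pow_nonneg hρ T) hc.le, one_div, pow_rpow_inv_natCast hρ hT]

/-- Lower bounds up to a constant and upper bounds for every larger rate determine the rate. -/
lemma tendsto_rpow_one_div_of_bounds {ρ c : ℝ} (hρ : 0 ≤ ρ) (hc : 0 < c) {u : ℕ → ℝ}
    (hlow : ∀ T, ρ ^ T * c ≤ u T)
    (hup : ∀ n : ℕ, ∀ᶠ T : ℕ in atTop, u T ≤ (ρ + 1 / (n + 1)) ^ T) :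
    Tendsto (fun T : ℕ => u T ^ (1 / (T : ℝ))) atTop (𝓝 ρ) := by
  have hlow0 : ∀ T, 0 ≤ ρ ^ T * c := fun T => by positivity
  refine tendsto_order.2 ⟨fun x hx => ?_, fun x hx => ?_⟩
  · filter_upwards [(tendsto_pow_mul_rpow_one_div hρ hc).eventually_const_lt hx] with T hT
    exact hT.trans_le (rpow_le_rpow (hlow0 T) (hlow T) (by positivity))
  · obtain ⟨n, hn⟩ := exists_nat_one_div_lt (sub_pos.2 hx)
    filter_upwards [hup n, eventually_ne_atTop 0] with T hT hT0
    have hn0 : 0 ≤ ρ + 1 / ((n : ℝ) + 1) := by positivity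
    calc u T ^ (1 / (T : ℝ)) ≤ ((ρ + 1 / ((n : ℝ) + 1)) ^ T) ^ (1 / (T : ℝ)) :=
          rpow_le_rpow ((hlow0 T).trans (hlow T)) hT (by positivity)
      _ = ρ + 1 / ((n : ℝ) + 1) := by rw [one_div (T : ℝ), pow_rpow_inv_natCast hn0 hT0]
      _ < x := by linarith

end Slingshot

theorem mainTheorem8 (m M : ℝ) (hm : 0 < m) (hmM : m ≤ M)
    {Ω : Type*} [MeasurableSpace Ω] (μ : Measure Ω) [IsProbabilityMeasure μ]
    (r h : ℕ → Ω → ℝ)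
    (hlaw : ∀ t, HasLaw (r t) (Slingshot.arcsineMeasure m M) μ)
    (hindep : iIndepFun r μ)
    (hh : ∀ t ω, h t ω = 1 / √(r t ω)) :
    -- convergence at rate `C`, where `C` does not depend on the problem or the initialization
    (∃ C : ℕ → Ω → ℝ,
      (∀ T, AEMeasurable (C T) μ) ∧ (∀ T ω, 0 ≤ C T ω) ∧
      (∀ᵐ ω ∂μ, Tendsto (fun T : ℕ => C T ω ^ (1 / (T : ℝ))) atTop
        (𝓝 ((√(M / m) - 1) / (√(M / m) + 1)))) ∧
      ∀ (dx dy : ℕ) (P : Slingshot.BilinearProblem dx dy), P.SpectralBounds m M →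
        ∀ z₀ : Slingshot.Z dx dy, ∃ zs : Slingshot.Z dx dy,
          Slingshot.IsSaddlePoint P.objective zs ∧
          (∀ (T : ℕ) (ω : Ω),
            ‖Slingshot.gda P.objective (Slingshot.slingshotX fun t => h t ω)
                (Slingshot.slingshotY fun t => h t ω) z₀ (2 * T) - zs‖ ≤ C T ω * ‖z₀ - zs‖) ∧
          (∀ᵐ ω ∂μ, Tendsto
            (Slingshot.gda P.objective (Slingshot.slingshotX fun t => h t ω)
              (Slingshot.slingshotY fun t => h t ω) z₀) atTop (𝓝 zs))) ∧
    -- optimality of the asymptotic rate among all first-order methods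
    (∀ (A : ℕ → Slingshot.BilinearMethod) (c : ℕ → ℝ),
      (∀ T, Slingshot.IsKrylovMethod (A T)) → Slingshot.HasRate A m M c →
      ∀ a : ℝ, a < (√(M / m) - 1) / (√(M / m) + 1) →
        ∀ᶠ T : ℕ in atTop, a < c T ^ (1 / (T : ℝ))) := by
  obtain ⟨a, b, ha, hb, hab, rfl, rfl⟩ : ∃ a b : ℝ, 0 < a ∧ 0 ≤ b ∧ b < a ∧ m = (a - b) ^ 2 ∧
      M = (a + b) ^ 2 := by
    have hm' : 0 < √m := sqrt_pos.2 hm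
    have hmM' : √m ≤ √M := sqrt_le_sqrt hmM
    refine ⟨(√M + √m) / 2, (√M - √m) / 2, by linarith, by linarith, by linarith, ?_, ?_⟩
    · rw [← sub_div, add_sub_sub_cancel, add_self_div_two, sq_sqrt hm.le]
    · rw [← add_div, add_add_sub_cancel, add_self_div_two, sq_sqrt (hm.le.trans hmM)]
  have hsub : 0 < a - b := sub_pos.2 hab
  have hrate : (√((a + b) ^ 2 / (a - b) ^ 2) - 1) / (√((a + b) ^ 2 / (a - b) ^ 2) + 1) = b / a := by
    rw [← div_pow, sqrt_sq (by positivity)]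
    field_simp
    ring
  rw [hrate]
  have hρ0 : 0 ≤ b / a := by positivity
  have hρ1 : 0 < 1 - b / a := sub_pos.2 ((div_lt_one ha).2 hab)
  have hheq : ∀ ω, (fun t => h t ω) = fun t => 1 / √(r t ω) := fun ω => funext fun t => hh t ω
  have hmem := Slingshot.ae_mem_Icc_of_hasLaw_arcsineMeasure hmM hlaw
  set K := Set.Icc ((a - b) ^ 2) ((a + b) ^ 2) with hK
  have hlim : ∀ᵐ ω ∂μ, Tendsto (fun T : ℕ => Slingshot.residualSup K T (fun t => h t ω) ^
      (1 / (T : ℝ))) atTop (𝓝 (b / a)) := by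
    have hup : ∀ᵐ ω ∂μ, ∀ n : ℕ, ∀ᶠ T : ℕ in atTop,
        Slingshot.residualSup K T (fun t => 1 / √(r t ω)) ≤ (b / a + 1 / ((n : ℝ) + 1)) ^ T :=
      ae_all_iff.2 fun n => Slingshot.ae_eventually_residualSup_le ha hb hab hlaw hindep
        (lt_add_of_pos_right _ (by positivity))
    filter_upwards [hup] with ω hω
    rw [← hheq] at hω
    exact Slingshot.tendsto_rpow_one_div_of_bounds hρ0 hρ1
      (fun T => Slingshot.pow_mul_one_sub_le_residualSup ha hb hab T _) hω
  refine ⟨⟨fun T ω => Slingshot.residualSup K T fun t => h t ω, fun T => ?_,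
    fun T ω => Slingshot.residualSup_nonneg _ _ _, hlim, fun dx dy P hP z₀ =>
    ⟨Slingshot.nearestSaddle P z₀, Slingshot.isSaddlePoint_nearestSaddle P z₀, ?_, ?_⟩⟩, ?_⟩
  · refine (Slingshot.continuous_residualSup isCompact_Icc T).measurable.comp_aemeasurable
      (aemeasurable_pi_iff.2 fun t => ?_)
    simp_rw [hh]
    exact ((hlaw t).aemeasurable.sqrt).const_div 1
  · intro T ω
    exact Slingshot.norm_gda_slingshot_sub_le P hP _ T (Slingshot.residualSup_nonneg _ _ _)
      (fun l hl => Slingshot.le_residualSup isCompact_Icc T _ hl) z₀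
  · filter_upwards [hlim, hmem] with ω hω hωK
    refine Slingshot.tendsto_gda_slingshot P _ (H := 1 / (a - b)) (fun t => ?_) z₀
      (Slingshot.adjoint_nearestSaddle P z₀) (Slingshot.apply_nearestSaddle P z₀) ?_
    · rw [hh, abs_of_nonneg (by positivity)]
      refine one_div_le_one_div_of_le hsub ?_
      rw [← sqrt_sq hsub.le]
      exact sqrt_le_sqrt (hωK t).1
    · -- eventually the `T`-th constant is at most `q ^ T` for some `q < 1`
      obtain ⟨q, hq, hq1⟩ := exists_between (sub_pos.1 hρ1)
      have hq0 : 0 ≤ q := hρ0.trans hq.le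
      rw [tendsto_iff_norm_sub_tendsto_zero]
      have hlim0 : Tendsto (fun T : ℕ => q ^ T * ‖z₀ - Slingshot.nearestSaddle P z₀‖) atTop
          (𝓝 0) := by
        simpa using (tendsto_pow_atTop_nhds_zero_of_lt_one hq0 hq1).mul_const
          ‖z₀ - Slingshot.nearestSaddle P z₀‖
      refine squeeze_zero' (Eventually.of_forall fun _ => norm_nonneg _) ?_ hlim0
      filter_upwards [hω.eventually_lt_const hq, eventually_ne_atTop 0] with T hT hT0
      refine (Slingshot.norm_gda_slingshot_sub_le P hP _ T (Slingshot.residualSup_nonneg _ _ _)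
        (fun l hl => Slingshot.le_residualSup isCompact_Icc T _ hl) z₀).trans
        (mul_le_mul_of_nonneg_right ?_ (norm_nonneg _))
      have hC0 := Slingshot.residualSup_nonneg K T fun t => h t ω
      rw [one_div] at hT
      calc Slingshot.residualSup K T (fun t => h t ω)
          = (Slingshot.residualSup K T (fun t => h t ω) ^ ((T : ℝ)⁻¹)) ^ T :=
            (rpow_inv_natCast_pow hC0 hT0).symm
        _ ≤ q ^ T := pow_le_pow_left₀ (rpow_nonneg hC0 _) hT.le T
  · intro A c hA hc x hx
    filter_upwards [(Slingshot.tendsto_pow_mul_rpow_one_div hρ0 hρ1).eventually_const_lt hx]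
      with T hT
    exact hT.trans_le (rpow_le_rpow (by positivity)
      (Slingshot.pow_mul_one_sub_le_of_hasRate ha hb hab hA hc T) (by positivity))
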